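/- Let $\mathcal H_{A'},\mathcal H_{B'},\mathcal H_E$ be complex Hilbert spaces, and let $p_{XY}$ be a probability distribution on $\{0,1\}^2$. A (single-round 2-2-2) measurement strategy on $(\mathcal H_{A'},\mathcal H_{B'})$ consists of two-outcome POVMs $\{M_{a|x}\}_{a\in\{0,1\}}$ on $\mathcal H_{A'}$ for $x\in\{0,1\}$ and $\{N_{b|y}\}_{b\in\{0,1\}}$ on $\mathcal H_{B'}$ for $y\in\{0,1\}$; it is projective if all $M_{a|x}$ and $N_{b|y}$ are projectors. With $\mathcal N$ the channel associated with the strategy and $p_{XY}$, a density operator $\rho$ on $\mathcal H_{A'}\otimes\mathcal H_{B'}\otimes\mathcal H_E$ is sent to the post-measurement state $$(\mathcal N\otimes\mathcal I_E)(\rho)=\sum_{a,b,x,y}p_{XY}(x,y)\,|a\rangle\langle a|\otimes|b\rangle\langle b|\otimes|x\rangle\langle x|\otimes|y\rangle\langle y|\otimes\operatorname{tr}_{A'B'}\big((M_{a|x}\otimes N_{b|y}\otimes 1_E)\rho\big)$$ on $\mathbb C^2\otimes\mathbb C^2\otimes\mathbb C^2\otimes\mathbb C^2\otimes\mathcal H_E$.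 Let a measurement strategy on $(\mathcal H_{A'},\mathcal H_{B'})$ with associated channel $\mathcal N$ and a density operator $\rho$ on $\mathcal H_{A'}\otimes\mathcal H_{B'}\otimes\mathcal H_E$ be given. (1) Suppose that $\mathcal H_{A'}=\bigoplus_{\alpha\in I}\mathcal H^\alpha_{A'}$ and $\mathcal H_{B'}=\bigoplus_{\beta\in J}\mathcal H^\beta_{B'}$ are orthogonal decompositions into two-dimensional subspaces, with orthogonal projectors $\Pi^\alpha_{A'}$ and $\Pi^\beta_{B'}$, that the strategy is projective, that every $M_{a|x}$ preserves every $\mathcal H^\alpha_{A'}$ and every $N_{b|y}$ preserves every $\mathcal H^\beta_{B'}$, and that $$\rho=\sum_{\alpha,\beta}(\Pi^\alpha_{A'}\otimes\Pi^\beta_{B'}\otimes 1_E)\,\rho\,(\Pi^\alpha_{A'}\otimes\Pi^\beta_{B'}\otimes 1_E).$$ Then there are weights $p_\lambda\ge 0$, $\lambda\in I\times J$, with $\sum_\lambda p_\lambda=1$, measurement strategies on $(\mathbb C^2,\mathbb C^2)$ with associated channels $\mathcal N_\lambda$ for the same distribution $p_{XY}$, and density operators $\rho^\lambda$ on $\mathbb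 C^2\otimes\mathbb C^2\otimes\mathcal H_E$ such that $$(\mathcal N\otimes\mathcal I_E)(\rho)=\sum_\lambda p_\lambda\,(\mathcal N_\lambda\otimes\mathcal I_E)(\rho^\lambda).$$ (The combination is finite if there are finitely many blocks, and otherwise a norm-convergent series.) (2) Consequently, for an arbitrary measurement strategy on finite-dimensional $\mathcal H_{A'},\mathcal H_{B'}$ and an arbitrary density operator $\rho$ ($\mathcal H_E$ being any Hilbert space), the post-measurement state $(\mathcal N\otimes\mathcal I_E)(\rho)$ is a finite convex combination $\sum_\lambda p_\lambda(\mathcal N_\lambda\otimes\mathcal I_E)(\rho^\lambda)$ of post-measurement states of strategies in which both parties hold qubits, as in (1). -/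

import Mathlib

open scoped TensorProduct InnerProductSpace

noncomputable section

namespace BellStrategy

section HilbertTensor

variable (H K : Type*) [NormedAddCommGroup H] [InnerProductSpace ℂ H]
  [NormedAddCommGroup K] [InnerProductSpace ℂ K]

/-- The Hilbert space tensor product: the completion of the algebraic tensor product with respect
to the inner product with `⟪h ⊗ k, h' ⊗ k'⟫ = ⟪h, h'⟫ * ⟪k, k'⟫`. -/
abbrev HTensor : Type _ := UniformSpace.Completion (H ⊗[ℂ] K)

variable {H K}

/-- The operator `S ⊗ T` on the Hilbert space tensor product: the continuous extension of the
algebraic tensor product of the bounded operators `S` and `T`. -/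
def opTensor (S : H →L[ℂ] H) (T : K →L[ℂ] K) : HTensor H K →L[ℂ] HTensor H K :=
  ((UniformSpace.Completion.toComplL (𝕜 := ℂ) (E := H ⊗[ℂ] K)) ∘L
    TensorProduct.mapL S T).extend (UniformSpace.Completion.toComplL (𝕜 := ℂ) (E := H ⊗[ℂ] K))

/-- The bounded operator `K → H ⊗ K`, `k ↦ h ⊗ k`. -/
def ketTensor (h : H) : K →L[ℂ] HTensor H K :=
  (UniformSpace.Completion.toComplL (𝕜 := ℂ) (E := H ⊗[ℂ] K)) ∘L TensorProduct.mkL ℂ H K h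

end HilbertTensor

section States

variable {H K : Type*} [NormedAddCommGroup H] [InnerProductSpace ℂ H] [CompleteSpace H]
  [NormedAddCommGroup K] [InnerProductSpace ℂ K] [CompleteSpace K]

/-- Density operators: positive bounded operators with trace `1`, the trace being the sum of the
diagonal entries in any orthonormal (Hilbert) basis. -/
def IsDensity (ρ : H →L[ℂ] H) : Prop :=
  ρ.IsPositive ∧ ∀ (s : Set H) (b : HilbertBasis s ℂ H), HasSum (fun i => ⟪b i, ρ (b i)⟫_ℂ) 1

variable (H) in
/-- The index set of a chosen Hilbert basis of `H`. -/
def basisSet : Set H := (exists_hilbertBasis ℂ H).choose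

variable (H) in
/-- A chosen Hilbert basis of `H`. -/
def someBasis : HilbertBasis (basisSet H) ℂ H := (exists_hilbertBasis ℂ H).choose_spec.choose

/-- The partial trace over the first factor, `∑ᵢ (⟨bᵢ| ⊗ 1) T (|bᵢ⟩ ⊗ 1)` for a Hilbert basis
`(bᵢ)` of the first factor. For trace class `T`, the only case in which it is used, the series
converges absolutely in norm and its sum does not depend on the basis. -/
def partialTrace (T : HTensor H K →L[ℂ] HTensor H K) : K →L[ℂ] K :=
  ∑' i, (ContinuousLinearMap.adjoint (ketTensor (K := K) (someBasis H i))) ∘L T ∘L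
    ketTensor (someBasis H i)

end States

/-- The two-dimensional Hilbert space `ℂ²`. -/
abbrev Qubit : Type := EuclideanSpace ℂ (Fin 2)

/-- The projector `|i⟩⟨i|` onto the `i`-th computational basis vector of `ℂ²`. -/
def ketBra (i : Fin 2) : Qubit →L[ℂ] Qubit :=
  InnerProductSpace.rankOne ℂ (EuclideanSpace.single i (1 : ℂ)) (EuclideanSpace.single i (1 : ℂ))

section Strategies

variable (HA HB : Type*) [NormedAddCommGroup HA] [InnerProductSpace ℂ HA]
  [NormedAddCommGroup HB] [InnerProductSpace ℂ HB]

/-- A single-round 2-2-2 measurement strategy on `HA` and `HB`: for each input `x` a two-outcome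
POVM `(M x 0, M x 1)` on `HA`, and for each input `y` a two-outcome POVM `(N y 0, N y 1)`
on `HB`. -/
structure MeasurementStrategy where
  /-- `M x a` is the element `M_{a|x}`. -/
  M : Fin 2 → Fin 2 → (HA →L[ℂ] HA)
  /-- `N y b` is the element `N_{b|y}`. -/
  N : Fin 2 → Fin 2 → (HB →L[ℂ] HB)
  M_pos : ∀ x a, (M x a).IsPositive
  M_sum : ∀ x, ∑ a, M x a = 1
  N_pos : ∀ y b, (N y b).IsPositive
  N_sum : ∀ y, ∑ b, N y b = 1

variable {HA HB}

/-- All the POVMs of the strategy are projective. -/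
def MeasurementStrategy.IsProjective (S : MeasurementStrategy HA HB) : Prop :=
  (∀ x a, S.M x a * S.M x a = S.M x a) ∧ (∀ y b, S.N y b * S.N y b = S.N y b)

variable [CompleteSpace HA] [CompleteSpace HB] {HE : Type*} [NormedAddCommGroup HE]
  [InnerProductSpace ℂ HE] [CompleteSpace HE]

/-- The Hilbert space of the registers `A, B, X, Y` (four qubits) and of the system `E`. -/
abbrev OutSpace (HE : Type*) [NormedAddCommGroup HE] [InnerProductSpace ℂ HE] : Type _ :=
  HTensor (HTensor (HTensor (HTensor Qubit Qubit) Qubit) Qubit) HE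

/-- The post-measurement state
`∑ p(x,y) |a⟩⟨a| ⊗ |b⟩⟨b| ⊗ |x⟩⟨x| ⊗ |y⟩⟨y| ⊗ tr_{A'B'} ((M_{a|x} ⊗ N_{b|y} ⊗ 1) ρ)`
obtained by applying the channel associated with `S` and `p`, tensored with the identity channel
on `E`, to `ρ`. -/
def MeasurementStrategy.postMeasurement (S : MeasurementStrategy HA HB) (p : Fin 2 × Fin 2 → ℝ)
    (ρ : HTensor (HTensor HA HB) HE →L[ℂ] HTensor (HTensor HA HB) HE) :
    OutSpace HE →L[ℂ] OutSpace HE :=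
  ∑ a : Fin 2, ∑ b : Fin 2, ∑ x : Fin 2, ∑ y : Fin 2, (p (x, y) : ℂ) •
    opTensor (opTensor (opTensor (opTensor (ketBra a) (ketBra b)) (ketBra x)) (ketBra y))
      (partialTrace (opTensor (opTensor (S.M x a) (S.N y b)) (1 : HE →L[ℂ] HE) * ρ))

/-- `τ` is a convex combination, with weights indexed by `Λ`, of post-measurement states of
strategies in which both parties hold qubits, for the input distribution `p`. For infinite `Λ`
the combination is a series; since all its terms are positive and the traces add up, convergence
in operator norm to the state `τ` is the same as convergence in trace norm. -/
def IsQubitMixture (Λ : Type*) (p : Fin 2 × Fin 2 → ℝ) (τ : OutSpace HE →L[ℂ] OutSpace HE) :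
    Prop :=
  ∃ (w : Λ → ℝ) (S : Λ → MeasurementStrategy Qubit Qubit)
    (σ : Λ → (HTensor (HTensor Qubit Qubit) HE →L[ℂ] HTensor (HTensor Qubit Qubit) HE)),
    (∀ l, 0 ≤ w l) ∧ HasSum w 1 ∧ (∀ l, IsDensity (σ l)) ∧
      HasSum (fun l => (w l : ℂ) • (S l).postMeasurement p (σ l)) τ

end Strategies

section Blocks

/-- An orthogonal decomposition of the Hilbert space `H` into two-dimensional subspaces. -/
structure BlockDecomposition (ι H : Type*) [NormedAddCommGroup H] [InnerProductSpace ℂ H]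
    [CompleteSpace H] where
  block : ι → Submodule ℂ H
  finrank_block : ∀ i, Module.finrank ℂ (block i) = 2
  isHilbertSum : IsHilbertSum ℂ (fun i => block i) (fun i => (block i).subtypeₗᵢ)

instance finiteDimensional_block {ι H : Type*} [NormedAddCommGroup H] [InnerProductSpace ℂ H] [CompleteSpace H]
    (D : BlockDecomposition ι H) (i : ι) : FiniteDimensional ℂ (D.block i) :=
  FiniteDimensional.of_finrank_pos (by rw [D.finrank_block i]; norm_num)

/-- The orthogonal projector onto the `i`-th block. -/
def BlockDecomposition.proj {ι H : Type*} [NormedAddCommGroup H] [InnerProductSpace ℂ H]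
    [CompleteSpace H] (D : BlockDecomposition ι H) (i : ι) : H →L[ℂ] H :=
  (D.block i).starProjection

variable {ι κ HA HB HE : Type*} [NormedAddCommGroup HA] [InnerProductSpace ℂ HA] [CompleteSpace HA]
  [NormedAddCommGroup HB] [InnerProductSpace ℂ HB] [CompleteSpace HB]
  [NormedAddCommGroup HE] [InnerProductSpace ℂ HE] [CompleteSpace HE]

/-- The strategy is projective, and its projectors are block diagonal with respect to the given
decompositions of `HA` and `HB` into two-dimensional blocks. -/
def MeasurementStrategy.IsBlockDiagonal (S : MeasurementStrategy HA HB)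
    (D : BlockDecomposition ι HA) (D' : BlockDecomposition κ HB) : Prop :=
  S.IsProjective ∧ (∀ x a i, ∀ v ∈ D.block i, S.M x a v ∈ D.block i) ∧
    (∀ y b j, ∀ v ∈ D'.block j, S.N y b v ∈ D'.block j)

/-- `ρ = ∑ (Π^α ⊗ Π^β ⊗ 1) ρ (Π^α ⊗ Π^β ⊗ 1)`, the sum running over all pairs of blocks. -/
def IsBlockState (D : BlockDecomposition ι HA) (D' : BlockDecomposition κ HB)
    (ρ : HTensor (HTensor HA HB) HE →L[ℂ] HTensor (HTensor HA HB) HE) : Prop :=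
  HasSum (fun l : ι × κ =>
    opTensor (opTensor (D.proj l.1) (D'.proj l.2)) (1 : HE →L[ℂ] HE) * ρ *
      opTensor (opTensor (D.proj l.1) (D'.proj l.2)) (1 : HE →L[ℂ] HE)) ρ

end Blocks

end BellStrategy

end

/-! Both claims reduce to one notion, `IsQubitReduction`: each element of a POVM pair is a weak sum
`∑ᵢ Cᵢ† Qᵢ Cᵢ`, where the `Qᵢ` are again POVM pairs, now on `ℂ²`. Summing over outcomes gives `∑ᵢ
Cᵢ† Cᵢ = 1`. Reductions for the two parties multiply (`hasSum_inner_tensorMap`), and cyclicity of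
the trace moves `C = Cᵢ ⊗ Cⱼ` onto the state: the contribution of `(i, j)` comes from the qubit
POVMs applied to `(C ⊗ 1) ρ (C ⊗ 1)†`. The trace of this operator is the weight, its normalization
the qubit state, and the weights add up to `1`.

In infinite dimension the analysis rests on writing `ρ = ∑ₖ |vₖ⟩⟨vₖ|` with `∑ₖ ‖vₖ‖² = 1`. Partial
traces then have the matrix elements of `hasSum_inner_partialTrace`. On the diagonal all terms are
nonnegative, so sums may be exchanged; the weights dominate the operator norms, which gives norm
convergence (`hasSum_partialTrace_compress`).

Invariant blocks of dimension at most two yield a reduction: `Cᵢ` is a partial isometry from the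
block into `ℂ²`. This settles (1). For (2), Jordan's lemma (`exists_blocks_of_projections`) supplies
the blocks for two projections. POVM pairs with a finite reduction form a convex set, and each
effect is a convex combination of projections, so general POVMs follow without dilating the space.
-/

noncomputable section

namespace BellStrategy

open ContinuousLinearMap

/-! ### Bounded operators between Hilbert space tensor products. -/

section TensorMaps

variable {H K H' K' H'' K'' F : Type*}
  [NormedAddCommGroup H] [InnerProductSpace ℂ H] [NormedAddCommGroup K] [InnerProductSpace ℂ K]
  [NormedAddCommGroup H'] [InnerProductSpace ℂ H'] [NormedAddCommGroup K'] [InnerProductSpace ℂ K']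
  [NormedAddCommGroup H''] [InnerProductSpace ℂ H'']
  [NormedAddCommGroup K''] [InnerProductSpace ℂ K'']
  [NormedAddCommGroup F] [NormedSpace ℂ F]

/-- The bounded operator `S ⊗ T : H ⊗ K → H' ⊗ K'` between Hilbert space tensor products. -/
def tensorMap (S : H →L[ℂ] H') (T : K →L[ℂ] K') : HTensor H K →L[ℂ] HTensor H' K' :=
  ((UniformSpace.Completion.toComplL (𝕜 := ℂ) (E := H' ⊗[ℂ] K')) ∘L
    TensorProduct.mapL S T).extend (UniformSpace.Completion.toComplL (𝕜 := ℂ) (E := H ⊗[ℂ] K))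

/-- The bounded operator `H → H ⊗ K`, `h ↦ h ⊗ k`. -/
def tensorKet (k : K) : H →L[ℂ] HTensor H K :=
  (UniformSpace.Completion.toComplL (𝕜 := ℂ) (E := H ⊗[ℂ] K)) ∘L (TensorProduct.mkL ℂ H K).flip k

theorem tensorKet_apply (k : K) (h : H) : tensorKet k h = ketTensor h k := rfl

theorem ketTensor_apply (h : H) (k : K) :
    ketTensor h k = ((h ⊗ₜ[ℂ] k : H ⊗[ℂ] K) : HTensor H K) := rfl

theorem tensorMap_coe (S : H →L[ℂ] H') (T : K →L[ℂ] K') (x : H ⊗[ℂ] K) :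
    tensorMap S T (x : HTensor H K) = (TensorProduct.mapL S T x : H' ⊗[ℂ] K') :=
  ContinuousLinearMap.extend_eq
    ((UniformSpace.Completion.toComplL (𝕜 := ℂ) (E := H' ⊗[ℂ] K')) ∘L TensorProduct.mapL S T)
    (UniformSpace.Completion.denseRange_coe) (UniformSpace.Completion.isUniformInducing_coe _) x

@[simp]
theorem tensorMap_ketTensor (S : H →L[ℂ] H') (T : K →L[ℂ] K') (h : H) (k : K) :
    tensorMap S T (ketTensor h k) = ketTensor (S h) (T k) := by
  rw [ketTensor_apply, tensorMap_coe]; rfl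

theorem inner_ketTensor (h h' : H) (k k' : K) :
    ⟪ketTensor h k, ketTensor h' k'⟫_ℂ = ⟪h, h'⟫_ℂ * ⟪k, k'⟫_ℂ := by
  simp [ketTensor_apply, UniformSpace.Completion.inner_coe]

theorem norm_ketTensor (h : H) (k : K) : ‖ketTensor h k‖ = ‖h‖ * ‖k‖ := by
  simp [ketTensor_apply]

theorem clm_ext_ketTensor {S T : HTensor H K →L[ℂ] F}
    (h : ∀ u v, S (ketTensor u v) = T (ketTensor u v)) : S = T := by
  refine ContinuousLinearMap.ext fun x => ?_
  induction x using UniformSpace.Completion.induction_on with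
  | hp => exact isClosed_eq S.continuous T.continuous
  | ih x =>
    induction x using TensorProduct.induction_on with
    | zero => simp [UniformSpace.Completion.coe_zero]
    | tmul u v => exact h u v
    | add x y hx hy => simp [UniformSpace.Completion.coe_add, hx, hy]

theorem ext_inner_ketTensor {x y : HTensor H K}
    (h : ∀ u v, ⟪ketTensor u v, x⟫_ℂ = ⟪ketTensor u v, y⟫_ℂ) : x = y := by
  refine (InnerProductSpace.toDual ℂ (HTensor H K)).injective ?_
  refine clm_ext_ketTensor fun u v => ?_
  have := congrArg (starRingEnd ℂ) (h u v)
  simpa using this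

theorem tensorMap_comp (S : H →L[ℂ] H') (T : K →L[ℂ] K') (S' : H' →L[ℂ] H'') (T' : K' →L[ℂ] K'') :
    tensorMap (S' ∘L S) (T' ∘L T) = tensorMap S' T' ∘L tensorMap S T :=
  clm_ext_ketTensor fun u v => by simp

theorem norm_tensorMap_le (S : H →L[ℂ] H') (T : K →L[ℂ] K') :
    ‖tensorMap S T‖ ≤ ‖S‖ * ‖T‖ := by
  refine ContinuousLinearMap.opNorm_le_bound _ (by positivity) fun x => ?_
  induction x using UniformSpace.Completion.induction_on with
  | hp => exact isClosed_le (by fun_prop) (by fun_prop)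
  | ih x =>
    rw [tensorMap_coe, UniformSpace.Completion.norm_coe, UniformSpace.Completion.norm_coe]
    exact ContinuousLinearMap.le_of_opNorm_le _ (TensorProduct.norm_mapL_le S T) x

/-- The operator `T ↦ S ⊗ T`, as a bounded linear map. -/
def tensorMapRight (S : H →L[ℂ] H') : (K →L[ℂ] K') →L[ℂ] (HTensor H K →L[ℂ] HTensor H' K') :=
  LinearMap.mkContinuous
    { toFun := fun T => tensorMap S T
      map_add' := fun T T' => clm_ext_ketTensor fun u v => by simp
      map_smul' := fun c T => clm_ext_ketTensor fun u v => by simp } ‖S‖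
    fun T => norm_tensorMap_le S T

theorem norm_tensorKet_le (k : K) : ‖tensorKet (H := H) k‖ ≤ ‖k‖ :=
  ContinuousLinearMap.opNorm_le_bound _ (norm_nonneg _) fun h => by
    rw [tensorKet_apply, norm_ketTensor, mul_comm]

theorem norm_adjoint_tensorKet_apply_le [CompleteSpace H] (k : K) (x : HTensor H K) :
    ‖adjoint (tensorKet k) x‖ ≤ ‖k‖ * ‖x‖ := by
  refine ContinuousLinearMap.le_of_opNorm_le _ ?_ x
  rw [LinearIsometryEquiv.norm_map]
  exact norm_tensorKet_le k

variable [CompleteSpace H] [CompleteSpace K] [CompleteSpace H'] [CompleteSpace K']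

theorem adjoint_tensorMap (S : H →L[ℂ] H') (T : K →L[ℂ] K') :
    adjoint (tensorMap S T) = tensorMap (adjoint S) (adjoint T) := by
  refine clm_ext_ketTensor fun u v => ext_inner_ketTensor fun u' v' => ?_
  rw [adjoint_inner_right]
  simp [inner_ketTensor, adjoint_inner_right]

/-- The slice maps `1 ⊗ ⟨k|` intertwine `S ⊗ 1` and `S`. -/
theorem adjoint_tensorKet_tensorMap (S : H →L[ℂ] H') (k : K) (x : HTensor H K) :
    adjoint (tensorKet k) (tensorMap S 1 x) = S (adjoint (tensorKet k) x) := by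
  refine ext_inner_left ℂ fun u => ?_
  rw [adjoint_inner_right, ← adjoint_inner_left S, adjoint_inner_right, ← adjoint_inner_left,
    adjoint_tensorMap, tensorKet_apply, tensorKet_apply, tensorMap_ketTensor]
  congr 2
  exact congrArg (fun T : K →L[ℂ] K => T k) (star_one (K →L[ℂ] K))

/-- With `B = R†R` and `B' = R'†R'`, the tensor product is `(R ⊗ R')†(R ⊗ R')`. -/
theorem isPositive_tensorMap {B : H →L[ℂ] H} {B' : K →L[ℂ] K} (hB : B.IsPositive)
    (hB' : B'.IsPositive) : (tensorMap B B').IsPositive := by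
  obtain ⟨R, rfl⟩ := CStarAlgebra.nonneg_iff_eq_star_mul_self.mp
    ((nonneg_iff_isPositive B).mpr hB)
  obtain ⟨R', rfl⟩ := CStarAlgebra.nonneg_iff_eq_star_mul_self.mp
    ((nonneg_iff_isPositive B').mpr hB')
  rw [mul_def, mul_def, tensorMap_comp, star_eq_adjoint, star_eq_adjoint, ← adjoint_tensorMap]
  exact isPositive_adjoint_comp_self _

end TensorMaps

theorem hasSum_congr {α M : Type*} [AddCommMonoid M] [TopologicalSpace M] {f g : α → M} {c : M}
    (h : ∀ a, f a = g a) : HasSum f c ↔ HasSum g c := by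
  rw [funext h]

/-- Tonelli for series: the source of all later exchanges of summation over the vectors of a state
and over blocks or basis elements. -/
theorem hasSum_prod_of_nonneg {α β : Type*} {f : α × β → ℝ} {g : α → ℝ} {c : ℝ}
    (hf : ∀ p, 0 ≤ f p) (hfg : ∀ a, HasSum (fun b => f (a, b)) (g a)) (hg : HasSum g c) :
    HasSum f c := by
  have hs : Summable f := (summable_prod_of_nonneg hf).mpr
    ⟨fun a => (hfg a).summable, by simpa only [(hfg _).tsum_eq] using hg.summable⟩
  have := hs.hasSum.prod_fiberwise hfg
  rw [hg.unique this]
  exact hs.hasSum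

theorem inner_self_eq_ofReal {H : Type*} [NormedAddCommGroup H] [InnerProductSpace ℂ H] (x : H) :
    ⟪x, x⟫_ℂ = ((‖x‖ ^ 2 : ℝ) : ℂ) := by
  rw [inner_self_eq_norm_sq_to_K]; push_cast; rfl

theorem inner_mul_inner_swap {H : Type*} [NormedAddCommGroup H] [InnerProductSpace ℂ H]
    (x y : H) : ⟪x, y⟫_ℂ * ⟪y, x⟫_ℂ = ((‖⟪y, x⟫_ℂ‖ ^ 2 : ℝ) : ℂ) := by
  rw [← inner_conj_symm, Complex.conj_mul']; push_cast; rfl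

/-! ### Matrix elements and norm of the partial trace. -/

section PartialTrace

variable {H K : Type*} [NormedAddCommGroup H] [InnerProductSpace ℂ H]
  [NormedAddCommGroup K] [InnerProductSpace ℂ K] [CompleteSpace K]

/-- Bessel's inequality for the slices of a vector along an orthonormal family. -/
theorem sum_norm_sq_adjoint_ketTensor_le {ι : Type*} {b : ι → H} (hb : Orthonormal ℂ b)
    (u : HTensor H K) (s : Finset ι) :
    ∑ i ∈ s, ‖adjoint (ketTensor (K := K) (b i)) u‖ ^ 2 ≤ ‖u‖ ^ 2 := by
  classical
  set c : ι → K := fun i => adjoint (ketTensor (b i)) u with hc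
  -- `z` is the projection of `u` onto the span of the `bᵢ ⊗ K`, so `⟪z, u⟫ = ⟪z, z⟫` and
  -- Cauchy–Schwarz gives `‖z‖ ≤ ‖u‖`.
  set z : HTensor H K := ∑ i ∈ s, ketTensor (b i) (c i) with hz
  have h1 : ⟪z, u⟫_ℂ = ((∑ i ∈ s, ‖c i‖ ^ 2 : ℝ) : ℂ) := by
    rw [hz, sum_inner]
    push_cast
    refine Finset.sum_congr rfl fun i _ => ?_
    rw [← adjoint_inner_right, inner_self_eq_ofReal]
    push_cast; rfl
  have h2 : ⟪z, z⟫_ℂ = ((∑ i ∈ s, ‖c i‖ ^ 2 : ℝ) : ℂ) := by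
    rw [hz, sum_inner]
    push_cast
    refine Finset.sum_congr rfl fun i hi => ?_
    rw [inner_sum, Finset.sum_eq_single i]
    · rw [inner_ketTensor, inner_self_eq_ofReal, inner_self_eq_ofReal, hb.1 i]
      simp
    · intro j _ hj
      rw [inner_ketTensor, hb.2 hj.symm, zero_mul]
    · exact fun h => (h hi).elim
  have h3 : ‖z‖ ^ 2 = ∑ i ∈ s, ‖c i‖ ^ 2 := by
    rw [inner_self_eq_ofReal] at h2
    exact Complex.ofReal_injective h2
  have h4 : ∑ i ∈ s, ‖c i‖ ^ 2 ≤ ‖z‖ * ‖u‖ := by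
    have := norm_inner_le_norm (𝕜 := ℂ) z u
    rw [h1, Complex.norm_real, Real.norm_eq_abs] at this
    exact (le_abs_self _).trans this
  rw [← h3] at h4 ⊢
  have : ‖z‖ ≤ ‖u‖ := by
    by_contra! h
    nlinarith [norm_nonneg u, norm_nonneg z]
  exact pow_le_pow_left₀ (norm_nonneg _) this 2

theorem summable_norm_sq_adjoint_ketTensor {ι κ : Type*} {b : ι → H} (hb : Orthonormal ℂ b)
    {u : κ → HTensor H K} (hu : Summable fun k => ‖u k‖ ^ 2) :
    Summable fun q : κ × ι => ‖adjoint (ketTensor (K := K) (b q.2)) (u q.1)‖ ^ 2 := by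
  have hs (k : κ) := summable_of_sum_le (fun i => sq_nonneg _)
    (sum_norm_sq_adjoint_ketTensor_le hb (u k))
  refine (summable_prod_of_nonneg fun q => sq_nonneg _).mpr ⟨hs, ?_⟩
  refine Summable.of_nonneg_of_le (fun k => tsum_nonneg fun i => sq_nonneg _) (fun k => ?_) hu
  exact (hs k).tsum_le_of_sum_le (sum_norm_sq_adjoint_ketTensor_le hb (u k))

variable [CompleteSpace H]

/-- Both sides are `⟪h ⊗ e, u⟫`. Slicing along either factor is thus interchangeable, which turns
sums over the traced basis into Parseval sums in `H`. -/
theorem inner_adjoint_ketTensor (h : H) (e : K) (u : HTensor H K) :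
    ⟪e, adjoint (ketTensor h) u⟫_ℂ = ⟪h, adjoint (tensorKet e) u⟫_ℂ := by
  rw [adjoint_inner_right, adjoint_inner_right, tensorKet_apply]

variable {κ : Type*} {u v : κ → HTensor H K} {T : HTensor H K →L[ℂ] HTensor H K}

/-- The matrix elements of the partial trace of `∑ₖ |uₖ⟩⟨vₖ|`. -/
theorem hasSum_inner_partialTrace (hu : Summable fun k => ‖u k‖ ^ 2)
    (hv : Summable fun k => ‖v k‖ ^ 2) (hT : ∀ x, HasSum (fun k => ⟪v k, x⟫_ℂ • u k) (T x))
    (e f : K) :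
    HasSum (fun k => ⟪adjoint (tensorKet f) (v k), adjoint (tensorKet e) (u k)⟫_ℂ)
      ⟪e, partialTrace T f⟫_ℂ := by
  set b := someBasis H
  set g : κ × basisSet H → (K →L[ℂ] K) := fun q => InnerProductSpace.rankOne ℂ
    (adjoint (ketTensor (b q.2)) (u q.1)) (adjoint (ketTensor (b q.2)) (v q.1)) with hg
  have hgs : Summable g := by
    -- The norm of a rank-one operator is the product of the norms of its vectors, at most the sum
    -- of their squares. Absolute summability of the double family allows both orders of summation.
    refine Summable.of_norm_bounded
      ((summable_norm_sq_adjoint_ketTensor b.orthonormal hu).add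
        (summable_norm_sq_adjoint_ketTensor b.orthonormal hv)) fun q => ?_
    rw [hg, InnerProductSpace.norm_rankOne]
    nlinarith [sq_nonneg (‖adjoint (ketTensor (K := K) (b q.2)) (u q.1)‖ -
        ‖adjoint (ketTensor (K := K) (b q.2)) (v q.1)‖),
      sq_nonneg ‖adjoint (ketTensor (K := K) (b q.2)) (u q.1)‖,
      sq_nonneg ‖adjoint (ketTensor (K := K) (b q.2)) (v q.1)‖]
  have hrow (i : basisSet H) : HasSum (fun k => g (k, i))
      (adjoint (ketTensor (K := K) (b i)) ∘L T ∘L ketTensor (b i)) := by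
    have h1 : Summable fun k => g (k, i) :=
      hgs.comp_injective (i := fun k => (k, i)) fun _ _ h => (Prod.ext_iff.mp h).1
    convert h1.hasSum using 1
    ext x
    refine HasSum.unique ?_ (h1.hasSum.mapL (ContinuousLinearMap.apply ℂ K x))
    refine (hasSum_congr fun k => ?_).mp
      ((hT (ketTensor (b i) x)).mapL (adjoint (ketTensor (K := K) (b i))))
    simp [hg, adjoint_inner_left]
  -- Summing over `k` first gives the defining series of the partial trace; summing over the basis
  -- first, below, gives the claimed formula by Parseval.
  have hP : partialTrace T = ∑' q, g q :=
    ((Equiv.prodComm _ _).hasSum_iff.mpr hgs.hasSum |>.prod_fiberwise hrow).tsum_eq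
  rw [hP]
  have h2 : HasSum (fun q => ⟪e, g q f⟫_ℂ) ⟪e, (∑' q, g q) f⟫_ℂ :=
    (hgs.hasSum.mapL (ContinuousLinearMap.apply ℂ K f)).mapL (innerSL ℂ e)
  refine h2.prod_fiberwise fun k => ?_
  refine (hasSum_congr fun i => ?_).mp
    (b.hasSum_inner_mul_inner (adjoint (tensorKet f) (v k)) (adjoint (tensorKet e) (u k)))
  rw [hg, InnerProductSpace.rankOne_apply, inner_smul_right, inner_adjoint_ketTensor,
    ← inner_conj_symm, ← inner_adjoint_ketTensor (b i) f (v k), inner_conj_symm]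

theorem norm_partialTrace_le (hu : Summable fun k => ‖u k‖ ^ 2)
    (hv : Summable fun k => ‖v k‖ ^ 2) (hT : ∀ x, HasSum (fun k => ⟪v k, x⟫_ℂ • u k) (T x))
    {c : ℝ} (hc : HasSum (fun k => ‖v k‖ * ‖u k‖) c) : ‖partialTrace T‖ ≤ c := by
  have hc0 : 0 ≤ c := hc.nonneg fun k => by positivity
  refine opNorm_le_of_re_inner_le hc0 fun f e hf he => ?_
  have h := hasSum_inner_partialTrace hu hv hT e f
  have hb (k : κ) : ‖⟪adjoint (tensorKet f) (v k), adjoint (tensorKet e) (u k)⟫_ℂ‖ ≤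
      ‖v k‖ * ‖u k‖ := by
    refine (norm_inner_le_norm _ _).trans ?_
    have h1 := norm_adjoint_tensorKet_apply_le f (v k)
    have h2 := norm_adjoint_tensorKet_apply_le e (u k)
    rw [hf, one_mul] at h1
    rw [he, one_mul] at h2
    gcongr
  rw [inner_re_symm]
  refine (Complex.re_le_norm _).trans ?_
  rw [← h.tsum_eq, ← hc.tsum_eq]
  exact tsum_of_norm_bounded hc hb |>.trans_eq hc.tsum_eq.symm

end PartialTrace

/-! ### Density operators as sums of rank-one operators. -/

section Density

variable {H : Type*} [NormedAddCommGroup H] [InnerProductSpace ℂ H]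

/-- A density operator is a sum `∑ₖ |vₖ⟩⟨vₖ|` with `∑ₖ ‖vₖ‖² = 1`. -/
theorem IsDensity.exists_rankOne_decomposition [CompleteSpace H] {ρ : H →L[ℂ] H} (hρ : IsDensity ρ) :
    ∃ v : basisSet H → H, HasSum (fun k => ‖v k‖ ^ 2) 1 ∧
      ∀ x, HasSum (fun k => ⟪v k, x⟫_ℂ • v k) (ρ x) := by
  -- The vectors are the images `R bₖ` of a Hilbert basis; since `R` is self-adjoint, `‖R bₖ‖² =
  -- ⟪bₖ, ρ bₖ⟫`.
  set R : H →L[ℂ] H := CFC.sqrt ρ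
  have hsa : adjoint R = R := (CFC.sqrt_nonneg ρ).isSelfAdjoint
  have hR (x : H) : ρ x = R (R x) :=
    congrArg (fun T : H →L[ℂ] H => T x)
      (CFC.sqrt_mul_sqrt_self ρ ((nonneg_iff_isPositive ρ).mpr hρ.1)).symm
  refine ⟨fun k => R (someBasis H k), ?_, fun x => ?_⟩
  · rw [← Complex.hasSum_ofReal, Complex.ofReal_one]
    refine (hasSum_congr fun k => ?_).mp (hρ.2 _ (someBasis H))
    rw [hR, ← adjoint_inner_left, hsa, inner_self_eq_ofReal]
  · rw [hR]
    refine (hasSum_congr fun k => ?_).mp (((someBasis H).hasSum_repr (R x)).mapL R)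
    rw [map_smul, HilbertBasis.repr_apply_apply, ← adjoint_inner_left, hsa]

theorem hasSum_trace_of_rankOne {κ : Type*} {v : κ → H} {c : ℝ} {ρ : H →L[ℂ] H}
    (hv : HasSum (fun k => ‖v k‖ ^ 2) c) (hρ : ∀ x, HasSum (fun k => ⟪v k, x⟫_ℂ • v k) (ρ x))
    {ι : Type*} (b : HilbertBasis ι ℂ H) : HasSum (fun i => ⟪b i, ρ (b i)⟫_ℂ) (c : ℂ) := by
  have h1 : HasSum (fun q : κ × ι => ‖⟪b q.2, v q.1⟫_ℂ‖ ^ 2) c := by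
    refine hasSum_prod_of_nonneg (fun _ => sq_nonneg _) (fun k => ?_) hv
    rw [← Complex.hasSum_ofReal, ← inner_self_eq_ofReal]
    exact (hasSum_congr fun i => inner_mul_inner_swap _ _).mp (b.hasSum_inner_mul_inner (v k) (v k))
  have h2 : HasSum (fun q : ι × κ => ((‖⟪b q.1, v q.2⟫_ℂ‖ ^ 2 : ℝ) : ℂ)) (c : ℂ) :=
    Complex.hasSum_ofReal.mpr ((Equiv.prodComm _ _).hasSum_iff.mpr h1)
  refine h2.prod_fiberwise fun i => ?_
  refine (hasSum_congr fun k => ?_).mp ((hρ (b i)).mapL (innerSL ℂ (b i)))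
  rw [innerSL_apply_apply, inner_smul_right, inner_mul_inner_swap]

end Density

/-! ### Weakly convergent operator series and tensor products. -/

section WeakSums

theorem hasSum_mul_complex {ι κ : Type*} {f : ι → ℂ} {g : κ → ℂ} {a b : ℂ} (hf : HasSum f a)
    (hg : HasSum g b) : HasSum (fun l : ι × κ => f l.1 * g l.2) (a * b) :=
  hf.mul hg (summable_mul_of_summable_norm hf.summable.norm hg.summable.norm)

/-- Uniformly bounded partial sums give equicontinuous matrix elements, so pointwise convergence
extends from `D` to its closure, one argument at a time. -/
theorem hasSum_inner_of_dense {ι G : Type*} [NormedAddCommGroup G] [InnerProductSpace ℂ G]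
    {B : ι → G →L[ℂ] G} {T : G →L[ℂ] G} {D : Set G} (hD : Dense D) {c : ℝ}
    (hc : ∀ s : Finset ι, ‖∑ i ∈ s, B i‖ ≤ c)
    (h : ∀ x ∈ D, ∀ y ∈ D, HasSum (fun i => ⟪x, B i y⟫_ℂ) ⟪x, T y⟫_ℂ) (x y : G) :
    HasSum (fun i => ⟪x, B i y⟫_ℂ) ⟪x, T y⟫_ℂ := by
  have hsum (x y : G) (s : Finset ι) :
      ∑ i ∈ s, ⟪x, B i y⟫_ℂ = ⟪x, (∑ i ∈ s, B i) y⟫_ℂ := by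
    rw [sum_apply, inner_sum]
  have hc0 : 0 ≤ c := (norm_nonneg _).trans (hc ∅)
  have hdiff (x x' y y' : G) (s : Finset ι) :
      ‖⟪x, (∑ i ∈ s, B i) y⟫_ℂ - ⟪x', (∑ i ∈ s, B i) y'⟫_ℂ‖ ≤
        ‖x - x'‖ * (c * ‖y‖) + ‖x'‖ * (c * ‖y - y'‖) := by
    set A := ∑ i ∈ s, B i
    have e : ⟪x, A y⟫_ℂ - ⟪x', A y'⟫_ℂ = ⟪x - x', A y⟫_ℂ + ⟪x', A (y - y')⟫_ℂ := by
      rw [map_sub, inner_sub_left, inner_sub_right]; ring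
    rw [e]
    refine (norm_add_le _ _).trans (add_le_add ?_ ?_)
    · exact (norm_inner_le_norm _ _).trans
        (mul_le_mul_of_nonneg_left (A.le_of_opNorm_le (hc s) _) (norm_nonneg _))
    · exact (norm_inner_le_norm _ _).trans
        (mul_le_mul_of_nonneg_left (A.le_of_opNorm_le (hc s) _) (norm_nonneg _))
  have hleft : ∀ x ∈ D, ∀ y, HasSum (fun i => ⟪x, B i y⟫_ℂ) ⟪x, T y⟫_ℂ := by
    intro x hx y
    have hE : UniformEquicontinuous fun (s : Finset ι) (y : G) => ∑ i ∈ s, ⟪x, B i y⟫_ℂ := by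
      refine LipschitzWith.uniformEquicontinuous _ (Real.toNNReal (‖x‖ * c)) fun s => ?_
      refine LipschitzWith.of_dist_le' fun y y' => ?_
      rw [dist_eq_norm, dist_eq_norm, hsum, hsum]
      refine (hdiff x x y y' s).trans_eq ?_
      simp [mul_assoc]
    refine (hE.equicontinuous y).tendsto_of_mem_closure (f := fun y => ⟪x, T y⟫_ℂ) (s := D) ?_
      (fun y hy => h x hx y hy) (hD y)
    exact (show Continuous fun y => ⟪x, T y⟫_ℂ by fun_prop).continuousAt.mono_left inf_le_left
  have hE : UniformEquicontinuous fun (s : Finset ι) (x : G) => ∑ i ∈ s, ⟪x, B i y⟫_ℂ := by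
    refine LipschitzWith.uniformEquicontinuous _ (Real.toNNReal (c * ‖y‖)) fun s => ?_
    refine LipschitzWith.of_dist_le' fun x x' => ?_
    rw [dist_eq_norm, dist_eq_norm, hsum, hsum]
    refine (hdiff x x' y y s).trans_eq ?_
    simp [mul_comm]
  refine (hE.equicontinuous x).tendsto_of_mem_closure (f := fun x => ⟪x, T y⟫_ℂ) (s := D) ?_
    (fun x hx => hleft x hx y) (hD x)
  exact (show Continuous fun x => ⟪x, T y⟫_ℂ by fun_prop).continuousAt.mono_left inf_le_left

/-- The hypothesis on the quadratic form says `A ≤ c • 1`, which for a positive element of a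
C⋆-algebra is the norm bound. -/
theorem norm_le_of_re_inner_le {G : Type*} [NormedAddCommGroup G] [InnerProductSpace ℂ G]
    [CompleteSpace G] {A : G →L[ℂ] G} (hA : A.IsPositive) {c : ℝ} (hc : 0 ≤ c)
    (h : ∀ x, (⟪x, A x⟫_ℂ).re ≤ c * ‖x‖ ^ 2) : ‖A‖ ≤ c := by
  rw [CStarAlgebra.norm_le_iff_le_algebraMap A hc ((nonneg_iff_isPositive A).mpr hA), le_def,
    isPositive_def']
  have hsm : algebraMap ℝ (G →L[ℂ] G) c = (c : ℂ) • 1 := by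
    rw [Algebra.algebraMap_eq_smul_one, Complex.coe_smul]
  refine ⟨?_, fun x => ?_⟩
  · exact (IsSelfAdjoint.algebraMap _ (IsSelfAdjoint.all c)).sub hA.isSelfAdjoint
  · rw [reApplyInnerSelf_apply, inner_re_symm, hsm, sub_apply, inner_sub_right, smul_apply,
      one_apply_eq_self, inner_smul_right, inner_self_eq_ofReal, map_sub]
    have := h x
    simp only [RCLike.re_eq_complex_re, Complex.re_ofReal_mul, Complex.ofReal_re]
    linarith

variable {H K : Type*} [NormedAddCommGroup H] [InnerProductSpace ℂ H]
  [NormedAddCommGroup K] [InnerProductSpace ℂ K]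

theorem hasSum_inner_tensorMap_coe {ι κ : Type*} {B : ι → H →L[ℂ] H} {M : H →L[ℂ] H}
    {B' : κ → K →L[ℂ] K} {M' : K →L[ℂ] K}
    (h : ∀ u v, HasSum (fun i => ⟪u, B i v⟫_ℂ) ⟪u, M v⟫_ℂ)
    (h' : ∀ u v, HasSum (fun j => ⟪u, B' j v⟫_ℂ) ⟪u, M' v⟫_ℂ) (x y : H ⊗[ℂ] K) :
    HasSum (fun l : ι × κ => ⟪(x : HTensor H K), tensorMap (B l.1) (B' l.2) y⟫_ℂ)
      ⟪(x : HTensor H K), tensorMap M M' y⟫_ℂ := by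
  induction x using TensorProduct.induction_on with
  | zero => simp [UniformSpace.Completion.coe_zero]
  | add x x' hx hx' => simpa [UniformSpace.Completion.coe_add, inner_add_left] using hx.add hx'
  | tmul u v =>
    induction y using TensorProduct.induction_on with
    | zero => simp [UniformSpace.Completion.coe_zero]
    | add y y' hy hy' =>
      simpa [UniformSpace.Completion.coe_add, inner_add_right] using hy.add hy'
    | tmul u' v' =>
      simp only [← ketTensor_apply, tensorMap_ketTensor, inner_ketTensor]
      have := hasSum_mul_complex (h u u') (h' v v')
      exact this

variable [CompleteSpace H] [CompleteSpace K]

/-- Weakly convergent series of positive operators can be multiplied with respect to the tensor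
product. -/
theorem hasSum_inner_tensorMap {ι κ : Type*} {B : ι → H →L[ℂ] H} {M : H →L[ℂ] H}
    {B' : κ → K →L[ℂ] K} {M' : K →L[ℂ] K} (hpos : ∀ i, (B i).IsPositive)
    (hpos' : ∀ j, (B' j).IsPositive)
    (h : ∀ u v, HasSum (fun i => ⟪u, B i v⟫_ℂ) ⟪u, M v⟫_ℂ)
    (h' : ∀ u v, HasSum (fun j => ⟪u, B' j v⟫_ℂ) ⟪u, M' v⟫_ℂ) (x y : HTensor H K) :
    HasSum (fun l : ι × κ => ⟪x, tensorMap (B l.1) (B' l.2) y⟫_ℂ) ⟪x, tensorMap M M' y⟫_ℂ := by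
  have halg := hasSum_inner_tensorMap_coe h h'
  have hposl (l : ι × κ) := isPositive_tensorMap (hpos l.1) (hpos' l.2)
  -- The terms are positive, so on the algebraic tensor product each finite partial sum has
  -- quadratic form below that of the full sum `M ⊗ M'`. This makes `‖M ⊗ M'‖` a uniform bound.
  refine hasSum_inner_of_dense (UniformSpace.Completion.denseRange_coe (α := H ⊗[ℂ] K))
    (c := ‖tensorMap M M'‖) (fun s => ?_) ?_ x y
  · refine norm_le_of_re_inner_le (isPositive_sum _ fun l _ => hposl l) (opNorm_nonneg _) fun x => ?_
    induction x using UniformSpace.Completion.induction_on with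
    | hp => exact isClosed_le (by fun_prop) (by fun_prop)
    | ih x =>
      have h1 := (halg x x).mapL Complex.reCLM
      have h2 := sum_le_hasSum s (fun l _ => (hposl l).re_inner_nonneg_right x) h1
      rw [sum_apply, inner_sum, Complex.re_sum]
      refine h2.trans ?_
      refine (Complex.re_le_norm _).trans ((norm_inner_le_norm _ _).trans ?_)
      rw [sq, ← mul_assoc, mul_comm]
      gcongr
      exact le_opNorm _ _
  · rintro _ ⟨x, rfl⟩ _ ⟨y, rfl⟩
    exact halg x y

theorem hasSum_inner_tensorMap_one {ι : Type*} {B : ι → H →L[ℂ] H} {M : H →L[ℂ] H}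
    (hpos : ∀ i, (B i).IsPositive) (h : ∀ u v, HasSum (fun i => ⟪u, B i v⟫_ℂ) ⟪u, M v⟫_ℂ)
    (x y : HTensor H K) :
    HasSum (fun i => ⟪x, tensorMap (B i) (1 : K →L[ℂ] K) y⟫_ℂ)
      ⟪x, tensorMap M (1 : K →L[ℂ] K) y⟫_ℂ := by
  have h1 (u v : K) : HasSum (fun _ : Unit => ⟪u, (1 : K →L[ℂ] K) v⟫_ℂ) ⟪u, (1 : K →L[ℂ] K) v⟫_ℂ :=
    hasSum_unique fun _ : Unit => ⟪u, (1 : K →L[ℂ] K) v⟫_ℂ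
  have h2 := hasSum_inner_tensorMap (B' := fun _ : Unit => (1 : K →L[ℂ] K)) hpos
    (fun _ => isPositive_one) h h1 x y
  rw [← (Equiv.prodPUnit ι).hasSum_iff]
  exact h2

end WeakSums

/-! ### Compressed states and their partial traces. -/

section Compression

variable {H H' K : Type*} [NormedAddCommGroup H] [InnerProductSpace ℂ H]
  [NormedAddCommGroup H'] [InnerProductSpace ℂ H']
  [NormedAddCommGroup K] [InnerProductSpace ℂ K]

/-- The operator `(C ⊗ 1) ρ (C ⊗ 1)†`. -/
def compress (C : H →L[ℂ] H') (ρ : HTensor H K →L[ℂ] HTensor H K) :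
    HTensor H' K →L[ℂ] HTensor H' K :=
  tensorMap C 1 ∘L ρ ∘L adjoint (tensorMap C 1)

theorem hasSum_compress {κ : Type*} {v : κ → HTensor H K}
    {ρ : HTensor H K →L[ℂ] HTensor H K} (hρ : ∀ x, HasSum (fun k => ⟪v k, x⟫_ℂ • v k) (ρ x))
    (C : H →L[ℂ] H') (x : HTensor H' K) :
    HasSum (fun k => ⟪tensorMap C (1 : K →L[ℂ] K) (v k), x⟫_ℂ • tensorMap C (1 : K →L[ℂ] K) (v k))
      (compress C ρ x) := by
  refine (hasSum_congr fun k => ?_).mp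
    ((hρ (adjoint (tensorMap C (1 : K →L[ℂ] K)) x)).mapL (tensorMap C (1 : K →L[ℂ] K)))
  rw [map_smul, adjoint_inner_right]

theorem summable_norm_sq_apply {κ E E' : Type*} [NormedAddCommGroup E] [NormedSpace ℂ E]
    [NormedAddCommGroup E'] [NormedSpace ℂ E'] {v : κ → E} (hv : Summable fun k => ‖v k‖ ^ 2)
    (T : E →L[ℂ] E') : Summable fun k => ‖T (v k)‖ ^ 2 := by
  refine Summable.of_nonneg_of_le (fun _ => sq_nonneg _) (fun k => ?_) (hv.mul_left (‖T‖ ^ 2))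
  rw [← mul_pow]
  exact pow_le_pow_left₀ (norm_nonneg _) (T.le_opNorm _) 2

variable [CompleteSpace H] [CompleteSpace H'] [CompleteSpace K] {κ : Type*} {v : κ → HTensor H K} {ρ : HTensor H K →L[ℂ] HTensor H K}

theorem hasSum_inner_partialTrace_mul (hv : Summable fun k => ‖v k‖ ^ 2)
    (hρ : ∀ x, HasSum (fun k => ⟪v k, x⟫_ℂ • v k) (ρ x)) (A : H →L[ℂ] H) (e : K) :
    HasSum (fun k => ⟪adjoint (tensorKet e) (v k), A (adjoint (tensorKet e) (v k))⟫_ℂ)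
      ⟪e, partialTrace (tensorMap A (1 : K →L[ℂ] K) * ρ) e⟫_ℂ := by
  have hT (x : HTensor H K) : HasSum (fun k => ⟪v k, x⟫_ℂ • tensorMap A (1 : K →L[ℂ] K) (v k))
      ((tensorMap A (1 : K →L[ℂ] K) * ρ) x) := by
    refine (hasSum_congr fun k => ?_).mp ((hρ x).mapL (tensorMap A (1 : K →L[ℂ] K)))
    rw [map_smul]
  refine (hasSum_congr fun k => ?_).mp
    (hasSum_inner_partialTrace (summable_norm_sq_apply hv _) hv hT e e)
  rw [adjoint_tensorKet_tensorMap]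

theorem norm_partialTrace_mul_le {c : ℝ} (hv : HasSum (fun k => ‖v k‖ ^ 2) c)
    (hρ : ∀ x, HasSum (fun k => ⟪v k, x⟫_ℂ • v k) (ρ x)) (A : H →L[ℂ] H) :
    ‖partialTrace (tensorMap A (1 : K →L[ℂ] K) * ρ)‖ ≤ ‖A‖ * c := by
  have hT (x : HTensor H K) : HasSum (fun k => ⟪v k, x⟫_ℂ • tensorMap A (1 : K →L[ℂ] K) (v k))
      ((tensorMap A (1 : K →L[ℂ] K) * ρ) x) := by
    refine (hasSum_congr fun k => ?_).mp ((hρ x).mapL (tensorMap A (1 : K →L[ℂ] K)))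
    rw [map_smul]
  have hA : ‖tensorMap A (1 : K →L[ℂ] K)‖ ≤ ‖A‖ :=
    (norm_tensorMap_le A 1).trans
      (mul_le_of_le_one_right (norm_nonneg _) norm_id_le)
  have hle (k : κ) : ‖v k‖ * ‖tensorMap A (1 : K →L[ℂ] K) (v k)‖ ≤ ‖A‖ * ‖v k‖ ^ 2 := by
    have := (tensorMap A (1 : K →L[ℂ] K)).le_of_opNorm_le hA (v k)
    nlinarith [norm_nonneg (v k)]
  have hs : Summable fun k => ‖v k‖ * ‖tensorMap A (1 : K →L[ℂ] K) (v k)‖ :=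
    Summable.of_nonneg_of_le (fun _ => by positivity) hle (hv.summable.mul_left _)
  exact (norm_partialTrace_le (summable_norm_sq_apply hv.summable _) hv.summable hT
    hs.hasSum).trans (hasSum_le hle hs.hasSum (hv.mul_left _))

/-- If `A = ∑ₗ Cₗ† Qₗ Cₗ` weakly, with positive contractions `Qₗ`, then
`tr₁ ((A ⊗ 1) ρ) = ∑ₗ tr₁ ((Qₗ ⊗ 1) (Cₗ ⊗ 1) ρ (Cₗ ⊗ 1)†)` in norm. -/
theorem hasSum_partialTrace_compress {Λ : Type*} {C : Λ → H →L[ℂ] H'} {Q : Λ → H' →L[ℂ] H'}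
    {A : H →L[ℂ] H} {w : Λ → ℝ} (hv : Summable fun k => ‖v k‖ ^ 2)
    (hρ : ∀ x, HasSum (fun k => ⟪v k, x⟫_ℂ • v k) (ρ x)) (hpos : ∀ l, (Q l).IsPositive)
    (hQ : ∀ l, ‖Q l‖ ≤ 1)
    (hA : ∀ x, HasSum (fun l => ⟪C l x, Q l (C l x)⟫_ℂ) ⟪x, A x⟫_ℂ)
    (hw : ∀ l, HasSum (fun k => ‖tensorMap (C l) (1 : K →L[ℂ] K) (v k)‖ ^ 2) (w l))
    (hws : Summable w) :
    HasSum (fun l => partialTrace (tensorMap (Q l) (1 : K →L[ℂ] K) * compress (C l) ρ))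
      (partialTrace (tensorMap A (1 : K →L[ℂ] K) * ρ)) := by
  have hs : Summable fun l =>
      partialTrace (tensorMap (Q l) (1 : K →L[ℂ] K) * compress (C l) ρ) := by
    -- `w l` is the trace of the compressed state and `Q l` is a contraction, so `w l` bounds the
    -- norm of the `l`-th term.
    refine Summable.of_norm_bounded hws fun l => ?_
    refine (norm_partialTrace_mul_le (hw l) (hasSum_compress hρ (C l)) (Q l)).trans ?_
    exact mul_le_of_le_one_left ((hw l).nonneg fun _ => sq_nonneg _) (hQ l)
  convert hs.hasSum using 1
  -- A complex operator is determined by its quadratic form, so only nonnegative double series have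
  -- to be compared.
  refine ContinuousLinearMap.coe_injective ((ext_inner_map _ _).mp fun e => ?_)
  suffices h : ⟪e, partialTrace (tensorMap A (1 : K →L[ℂ] K) * ρ) e⟫_ℂ =
      ⟪e, (∑' l, partialTrace (tensorMap (Q l) (1 : K →L[ℂ] K) * compress (C l) ρ)) e⟫_ℂ by
    have := congrArg (starRingEnd ℂ) h
    rwa [inner_conj_symm, inner_conj_symm] at this
  set z : κ → H := fun k => adjoint (tensorKet e) (v k)
  set f : κ × Λ → ℂ := fun q => ⟪C q.2 (z q.1), Q q.2 (C q.2 (z q.1))⟫_ℂ with hf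
  have hfre (q : κ × Λ) : f q = ((f q).re : ℂ) :=
    (Complex.ext rfl (by simpa using (Complex.nonneg_iff.mp ((hpos q.2).inner_nonneg_right _)).2.symm))
  have hA' := hasSum_inner_partialTrace_mul hv hρ A e
  have hfs : Summable f := by
    have hre : HasSum (fun q => (f q).re)
        (⟪e, partialTrace (tensorMap A (1 : K →L[ℂ] K) * ρ) e⟫_ℂ).re :=
      hasSum_prod_of_nonneg
        (fun q => (Complex.nonneg_iff.mp ((hpos q.2).inner_nonneg_right _)).1)
        (fun k => (hA (z k)).mapL Complex.reCLM) (hA'.mapL Complex.reCLM)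
    rw [funext hfre]
    exact (Complex.hasSum_ofReal.mpr hre).summable
  have h1 : ⟪e, partialTrace (tensorMap A (1 : K →L[ℂ] K) * ρ) e⟫_ℂ = ∑' q, f q :=
    hA'.unique (hfs.hasSum.prod_fiberwise fun k => hA (z k))
  have h2 : HasSum (fun l => ⟪e, partialTrace (tensorMap (Q l) (1 : K →L[ℂ] K) *
      compress (C l) ρ) e⟫_ℂ) (∑' q, f q) := by
    refine ((Equiv.prodComm _ _).hasSum_iff.mpr hfs.hasSum).prod_fiberwise fun l => ?_
    refine (hasSum_congr fun k => ?_).mp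
      (hasSum_inner_partialTrace_mul (hw l).summable (hasSum_compress hρ (C l)) (Q l) e)
    rw [adjoint_tensorKet_tensorMap]
    rfl
  have h3 := (hs.hasSum.mapL (ContinuousLinearMap.apply ℂ K e)).mapL (innerSL ℂ e)
  exact h1.trans (h2.unique h3)

/-- The positive operators `Cₗ†Cₗ` sum weakly to `1`, hence so do the `Cₗ†Cₗ ⊗ 1`. Applied to the
vectors of a state, this shows that the weights sum to `1`. -/
theorem hasSum_norm_sq_tensorMap {Λ : Type*} {C : Λ → H →L[ℂ] H'}
    (hC : ∀ x y, HasSum (fun l => ⟪C l x, C l y⟫_ℂ) ⟪x, y⟫_ℂ) (x : HTensor H K) :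
    HasSum (fun l => ‖tensorMap (C l) (1 : K →L[ℂ] K) x‖ ^ 2) (‖x‖ ^ 2) := by
  have h1 (u v : H) : HasSum (fun l => ⟪u, (adjoint (C l) ∘L C l) v⟫_ℂ) ⟪u, (1 : H →L[ℂ] H) v⟫_ℂ :=
    (hasSum_congr fun l => by rw [comp_apply, adjoint_inner_right]).mp (hC u v)
  have h2 := hasSum_inner_tensorMap_one (K := K) (fun l => isPositive_adjoint_comp_self (C l)) h1 x x
  have hone : tensorMap (1 : H →L[ℂ] H) (1 : K →L[ℂ] K) = 1 := clm_ext_ketTensor fun u v => by simp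
  have hadj : adjoint (1 : K →L[ℂ] K) = 1 := star_one (K →L[ℂ] K)
  rw [← Complex.hasSum_ofReal, ← inner_self_eq_ofReal]
  rw [hone] at h2
  refine (hasSum_congr fun l => ?_).mp h2
  have : tensorMap (adjoint (C l) ∘L C l) (1 : K →L[ℂ] K) =
      adjoint (tensorMap (C l) (1 : K →L[ℂ] K)) ∘L tensorMap (C l) (1 : K →L[ℂ] K) := by
    rw [adjoint_tensorMap, ← tensorMap_comp, hadj]; rfl
  rw [this, comp_apply, adjoint_inner_right, inner_self_eq_ofReal]

end Compression

/-! ### From qubit reductions of both parties to a qubit mixture. -/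

section Reductions

/-- A qubit reduction of a pair of two-outcome POVMs `M`: operators `Cᵢ : H → ℂ²` and pairs of
two-outcome POVMs `Qᵢ` on `ℂ²` with `M_{a|x} = ∑ᵢ Cᵢ† Q_{i,a|x} Cᵢ` in the weak sense. -/
structure IsQubitReduction {ι H : Type*} [NormedAddCommGroup H] [InnerProductSpace ℂ H]
    (M : Fin 2 → Fin 2 → H →L[ℂ] H) (C : ι → H →L[ℂ] Qubit)
    (Q : ι → Fin 2 → Fin 2 → Qubit →L[ℂ] Qubit) : Prop where
  pos : ∀ i x a, (Q i x a).IsPositive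
  sum : ∀ i x, ∑ a, Q i x a = 1
  hasSum : ∀ x a u v, HasSum (fun i => ⟪C i u, Q i x a (C i v)⟫_ℂ) ⟪u, M x a v⟫_ℂ

theorem norm_le_one_of_isPositive_of_sum {E : Type*} [NormedAddCommGroup E]
    [InnerProductSpace ℂ E] [CompleteSpace E] {Q : Fin 2 → E →L[ℂ] E}
    (hpos : ∀ a, (Q a).IsPositive) (hsum : ∑ a, Q a = 1) (a : Fin 2) : ‖Q a‖ ≤ 1 := by
  refine norm_le_of_re_inner_le (hpos a) zero_le_one fun x => ?_
  have h1 : ∑ a, (⟪x, Q a x⟫_ℂ).re = ‖x‖ ^ 2 := by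
    rw [← Complex.re_sum, ← inner_sum, ← sum_apply, hsum, one_apply_eq_self, inner_self_eq_ofReal,
      Complex.ofReal_re]
  rw [one_mul, ← h1]
  exact Finset.single_le_sum (fun b _ => (hpos b).re_inner_nonneg_right x) (Finset.mem_univ a)

/-- Adding the two outcomes of one setting, here `0`, turns both `M` and every `Q i` into the
identity. -/
theorem IsQubitReduction.hasSum_inner {ι H : Type*} [NormedAddCommGroup H]
    [InnerProductSpace ℂ H] {M : Fin 2 → Fin 2 → H →L[ℂ] H} {C : ι → H →L[ℂ] Qubit}
    {Q : ι → Fin 2 → Fin 2 → Qubit →L[ℂ] Qubit} (h : IsQubitReduction M C Q)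
    (hM : ∀ x, ∑ a, M x a = 1) (u v : H) :
    HasSum (fun i => ⟪C i u, C i v⟫_ℂ) ⟪u, v⟫_ℂ := by
  have h1 := hasSum_sum fun a (_ : a ∈ Finset.univ) => h.hasSum 0 a u v
  rw [← inner_sum, ← sum_apply, hM, one_apply_eq_self] at h1
  refine (hasSum_congr fun i => ?_).mp h1
  rw [← inner_sum, ← sum_apply, h.sum, one_apply_eq_self]

variable {HA HB HE : Type*} [NormedAddCommGroup HA] [InnerProductSpace ℂ HA] [CompleteSpace HA]
  [NormedAddCommGroup HB] [InnerProductSpace ℂ HB] [CompleteSpace HB]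
  [NormedAddCommGroup HE] [InnerProductSpace ℂ HE] [CompleteSpace HE]
  {ι κ : Type*}

theorem hasSum_inner_tensorMap_conj {C : ι → HA →L[ℂ] Qubit} {Q : ι → Qubit →L[ℂ] Qubit}
    {M : HA →L[ℂ] HA} {C' : κ → HB →L[ℂ] Qubit} {Q' : κ → Qubit →L[ℂ] Qubit} {M' : HB →L[ℂ] HB}
    (hpos : ∀ i, (Q i).IsPositive) (hpos' : ∀ j, (Q' j).IsPositive)
    (h : ∀ u v, HasSum (fun i => ⟪C i u, Q i (C i v)⟫_ℂ) ⟪u, M v⟫_ℂ)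
    (h' : ∀ u v, HasSum (fun j => ⟪C' j u, Q' j (C' j v)⟫_ℂ) ⟪u, M' v⟫_ℂ) (x y : HTensor HA HB) :
    HasSum (fun l : ι × κ => ⟪tensorMap (C l.1) (C' l.2) x,
        tensorMap (Q l.1) (Q' l.2) (tensorMap (C l.1) (C' l.2) y)⟫_ℂ) ⟪x, tensorMap M M' y⟫_ℂ := by
  have h1 (u v : HA) :
      HasSum (fun i => ⟪u, (adjoint (C i) ∘L Q i ∘L C i) v⟫_ℂ) ⟪u, M v⟫_ℂ :=
    (hasSum_congr fun i => by rw [comp_apply, adjoint_inner_right]; rfl).mp (h u v)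
  have h2 (u v : HB) :
      HasSum (fun j => ⟪u, (adjoint (C' j) ∘L Q' j ∘L C' j) v⟫_ℂ) ⟪u, M' v⟫_ℂ :=
    (hasSum_congr fun j => by rw [comp_apply, adjoint_inner_right]; rfl).mp (h' u v)
  refine (hasSum_congr fun l => ?_).mp (hasSum_inner_tensorMap
    (fun i => (hpos i).adjoint_conj (C i)) (fun j => (hpos' j).adjoint_conj (C' j)) h1 h2 x y)
  rw [tensorMap_comp, tensorMap_comp, comp_apply, comp_apply, ← adjoint_tensorMap,
    adjoint_inner_right]

theorem hasSum_inner_tensorMap_of_isQubitReduction {CA : ι → HA →L[ℂ] Qubit}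
    {QA : ι → Fin 2 → Fin 2 → Qubit →L[ℂ] Qubit} {CB : κ → HB →L[ℂ] Qubit}
    {QB : κ → Fin 2 → Fin 2 → Qubit →L[ℂ] Qubit} {M : Fin 2 → Fin 2 → HA →L[ℂ] HA}
    {N : Fin 2 → Fin 2 → HB →L[ℂ] HB} (hA : IsQubitReduction M CA QA)
    (hB : IsQubitReduction N CB QB) (hM : ∀ x, ∑ a, M x a = 1) (hN : ∀ y, ∑ b, N y b = 1)
    (x y : HTensor HA HB) :
    HasSum (fun l : ι × κ => ⟪tensorMap (CA l.1) (CB l.2) x, tensorMap (CA l.1) (CB l.2) y⟫_ℂ)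
      ⟪x, y⟫_ℂ := by
  have h := hasSum_inner_tensorMap_conj (Q := fun _ => 1) (Q' := fun _ => 1) (M := 1) (M' := 1)
    (fun _ => isPositive_one) (fun _ => isPositive_one) (hA.hasSum_inner hM)
    (hB.hasSum_inner hN) x y
  have hone : tensorMap (1 : HA →L[ℂ] HA) (1 : HB →L[ℂ] HB) = 1 :=
    clm_ext_ketTensor fun u v => by simp
  have hone' : tensorMap (1 : Qubit →L[ℂ] Qubit) (1 : Qubit →L[ℂ] Qubit) = 1 :=
    clm_ext_ketTensor fun u v => by simp
  rw [hone, one_apply_eq_self] at h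
  refine (hasSum_congr fun l => ?_).mp h
  rw [hone', one_apply_eq_self]

theorem isPositive_compress {H H' K : Type*} [NormedAddCommGroup H] [InnerProductSpace ℂ H]
    [NormedAddCommGroup H'] [InnerProductSpace ℂ H'] [NormedAddCommGroup K] [InnerProductSpace ℂ K]
    {ρ : HTensor H K →L[ℂ] HTensor H K} (hρ : ρ.IsPositive) (C : H →L[ℂ] H') :
    (compress C ρ).IsPositive :=
  hρ.conj_adjoint _

theorem partialTrace_smul {H K : Type*} [NormedAddCommGroup H] [InnerProductSpace ℂ H]
    [CompleteSpace H] [NormedAddCommGroup K] [InnerProductSpace ℂ K] [CompleteSpace K]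
    (c : ℂ) (T : HTensor H K →L[ℂ] HTensor H K) :
    partialTrace (c • T) = c • partialTrace T := by
  rw [partialTrace, partialTrace, ← tsum_const_smul'']
  refine tsum_congr fun i => ?_
  rw [smul_comp, comp_smul]

theorem isDensity_smul_compress {H H' K κ : Type*} [NormedAddCommGroup H] [InnerProductSpace ℂ H]
    [NormedAddCommGroup H'] [InnerProductSpace ℂ H'] [NormedAddCommGroup K] [InnerProductSpace ℂ K]
    {ρ : HTensor H K →L[ℂ] HTensor H K} {v : κ → HTensor H K} (hpos : ρ.IsPositive)
    (hρ : ∀ x, HasSum (fun k => ⟪v k, x⟫_ℂ • v k) (ρ x)) {C : H →L[ℂ] H'} {w : ℝ}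
    (hw : HasSum (fun k => ‖tensorMap C (1 : K →L[ℂ] K) (v k)‖ ^ 2) w) (hw0 : w ≠ 0) :
    IsDensity ((w⁻¹ : ℂ) • compress C ρ) := by
  have hw1 : 0 ≤ w⁻¹ := inv_nonneg.mpr (hw.nonneg fun _ => sq_nonneg _)
  refine ⟨(isPositive_compress hpos C).smul_of_nonneg (by exact_mod_cast hw1), fun s b => ?_⟩
  have h := (hasSum_trace_of_rankOne hw (hasSum_compress hρ C) b).mul_left (w⁻¹ : ℂ)
  rw [inv_mul_cancel₀ (by exact_mod_cast hw0)] at h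
  refine (hasSum_congr fun i => ?_).mp h
  rw [smul_apply, inner_smul_right]

/-- Multiplication by the weight undoes the normalization. At weight zero `σ` is arbitrary, but
there the compressed operator contributes nothing, by the trace bound. -/
theorem smul_partialTrace_mul_normalized {H H' K κ : Type*} [NormedAddCommGroup H]
    [InnerProductSpace ℂ H] [NormedAddCommGroup H'] [InnerProductSpace ℂ H'] [CompleteSpace H']
    [NormedAddCommGroup K] [InnerProductSpace ℂ K] [CompleteSpace K]
    {ρ : HTensor H K →L[ℂ] HTensor H K} {v : κ → HTensor H K}
    (hρ : ∀ x, HasSum (fun k => ⟪v k, x⟫_ℂ • v k) (ρ x)) {C : H →L[ℂ] H'} {w : ℝ}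
    (hw : HasSum (fun k => ‖tensorMap C (1 : K →L[ℂ] K) (v k)‖ ^ 2) w)
    {σ : HTensor H' K →L[ℂ] HTensor H' K} (hσ : w ≠ 0 → σ = (w⁻¹ : ℂ) • compress C ρ)
    (A : H' →L[ℂ] H') :
    (w : ℂ) • partialTrace (tensorMap A (1 : K →L[ℂ] K) * σ) =
      partialTrace (tensorMap A (1 : K →L[ℂ] K) * compress C ρ) := by
  by_cases h : w = 0
  · subst h
    have h1 := norm_partialTrace_mul_le hw (hasSum_compress hρ C) A
    rw [mul_zero] at h1
    rw [norm_le_zero_iff.mp h1, Complex.ofReal_zero, zero_smul]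
  · rw [hσ h, mul_smul_comm, partialTrace_smul, smul_smul,
      mul_inv_cancel₀ (by exact_mod_cast h), one_smul]

/-- The weights `wₗ = tr ((Cₗ ⊗ 1) ρ (Cₗ ⊗ 1)†)` and the normalized states. -/
theorem exists_normalized_compress {H H' K κ Λ : Type*} [NormedAddCommGroup H]
    [InnerProductSpace ℂ H] [CompleteSpace H] [NormedAddCommGroup H'] [InnerProductSpace ℂ H']
    [CompleteSpace H'] [NormedAddCommGroup K] [InnerProductSpace ℂ K] [CompleteSpace K]
    {ρ : HTensor H K →L[ℂ] HTensor H K} {v : κ → HTensor H K} (hpos : ρ.IsPositive)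
    (hv : HasSum (fun k => ‖v k‖ ^ 2) 1) (hρ : ∀ x, HasSum (fun k => ⟪v k, x⟫_ℂ • v k) (ρ x))
    {C : Λ → H →L[ℂ] H'} (hC : ∀ x y, HasSum (fun l => ⟪C l x, C l y⟫_ℂ) ⟪x, y⟫_ℂ) :
    ∃ (w : Λ → ℝ) (σ : Λ → HTensor H' K →L[ℂ] HTensor H' K), HasSum w 1 ∧
      (∀ l, HasSum (fun k => ‖tensorMap (C l) (1 : K →L[ℂ] K) (v k)‖ ^ 2) (w l)) ∧
      (∀ l, IsDensity (σ l)) ∧ ∀ l, w l ≠ 0 → σ l = ((w l)⁻¹ : ℂ) • compress (C l) ρ := by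
  have htot : HasSum (fun q : κ × Λ => ‖tensorMap (C q.2) (1 : K →L[ℂ] K) (v q.1)‖ ^ 2) 1 :=
    hasSum_prod_of_nonneg (fun _ => sq_nonneg _) (fun k => hasSum_norm_sq_tensorMap hC (v k)) hv
  set w : Λ → ℝ := fun l => ∑' k, ‖tensorMap (C l) (1 : K →L[ℂ] K) (v k)‖ ^ 2
  have hw (l : Λ) : HasSum (fun k => ‖tensorMap (C l) (1 : K →L[ℂ] K) (v k)‖ ^ 2) (w l) :=
    (htot.summable.comp_injective (i := fun k => (k, l))
      fun _ _ h => (Prod.ext_iff.mp h).1).hasSum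
  have hw1 : HasSum w 1 := ((Equiv.prodComm _ _).hasSum_iff.mpr htot).prod_fiberwise hw
  -- Indices of weight zero still need some density operator; the normalized state at an index of
  -- nonzero weight serves for all of them.
  obtain ⟨l₀, hl₀⟩ : ∃ l, w l ≠ 0 := by
    by_contra! h
    exact zero_ne_one (hasSum_zero.unique (by simpa only [funext h] using hw1))
  have hex (l : Λ) : ∃ σ : HTensor H' K →L[ℂ] HTensor H' K, IsDensity σ ∧
      (w l ≠ 0 → σ = ((w l)⁻¹ : ℂ) • compress (C l) ρ) := by
    by_cases h : w l = 0
    · exact ⟨_, isDensity_smul_compress hpos hρ (hw l₀) hl₀, fun h' => (h' h).elim⟩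
    · exact ⟨_, isDensity_smul_compress hpos hρ (hw l) h, fun _ => rfl⟩
  choose σ hσ hσ' using hex
  exact ⟨w, σ, hw1, hw, hσ, hσ'⟩

theorem hasSum_partialTrace_of_isQubitReduction {CA : ι → HA →L[ℂ] Qubit}
    {QA : ι → Fin 2 → Fin 2 → Qubit →L[ℂ] Qubit} {CB : κ → HB →L[ℂ] Qubit}
    {QB : κ → Fin 2 → Fin 2 → Qubit →L[ℂ] Qubit} {M : Fin 2 → Fin 2 → HA →L[ℂ] HA}
    {N : Fin 2 → Fin 2 → HB →L[ℂ] HB} (hA : IsQubitReduction M CA QA)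
    (hB : IsQubitReduction N CB QB) {μ : Type*} {v : μ → HTensor (HTensor HA HB) HE}
    {ρ : HTensor (HTensor HA HB) HE →L[ℂ] HTensor (HTensor HA HB) HE} {w : ι × κ → ℝ}
    (hv : Summable fun k => ‖v k‖ ^ 2) (hρ : ∀ x, HasSum (fun k => ⟪v k, x⟫_ℂ • v k) (ρ x))
    (hw : ∀ l, HasSum (fun k =>
      ‖tensorMap (tensorMap (CA l.1) (CB l.2)) (1 : HE →L[ℂ] HE) (v k)‖ ^ 2) (w l))
    (hws : Summable w) (a b x y : Fin 2) :
    HasSum (fun l : ι × κ => partialTrace (tensorMap (tensorMap (QA l.1 x a) (QB l.2 y b))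
        (1 : HE →L[ℂ] HE) * compress (tensorMap (CA l.1) (CB l.2)) ρ))
      (partialTrace (tensorMap (tensorMap (M x a) (N y b)) (1 : HE →L[ℂ] HE) * ρ)) := by
  refine hasSum_partialTrace_compress hv hρ
    (fun l => isPositive_tensorMap (hA.pos l.1 x a) (hB.pos l.2 y b)) (fun l => ?_)
    (fun z => hasSum_inner_tensorMap_conj (fun i => hA.pos i x a) (fun j => hB.pos j y b)
      (hA.hasSum x a) (hB.hasSum y b) z z) hw hws
  refine (norm_tensorMap_le _ _).trans (mul_le_one₀ ?_ (norm_nonneg _) ?_)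
  · exact norm_le_one_of_isPositive_of_sum (hA.pos l.1 x) (hA.sum l.1 x) a
  · exact norm_le_one_of_isPositive_of_sum (hB.pos l.2 y) (hB.sum l.2 y) b

theorem hasSum_smul_opTensor {Λ H K : Type*} [NormedAddCommGroup H] [InnerProductSpace ℂ H]
    [NormedAddCommGroup K] [InnerProductSpace ℂ K] {f : Λ → K →L[ℂ] K} {t : K →L[ℂ] K}
    (h : HasSum f t) (R : H →L[ℂ] H) (c : ℂ) :
    HasSum (fun l => c • opTensor R (f l)) (c • opTensor R t) :=
  (h.mapL (tensorMapRight R)).const_smul c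

theorem smul_smul_opTensor {H K : Type*} [NormedAddCommGroup H] [InnerProductSpace ℂ H]
    [NormedAddCommGroup K] [InnerProductSpace ℂ K] (R : H →L[ℂ] H) (T : K →L[ℂ] K) (w c : ℂ) :
    w • c • opTensor R T = c • opTensor R (w • T) := by
  rw [smul_comm]
  exact congrArg (c • ·) (map_smul (tensorMapRight R) w T).symm

theorem hasSum_smul_sum_opTensor {Λ G K : Type*} [NormedAddCommGroup G] [InnerProductSpace ℂ G]
    [NormedAddCommGroup K] [InnerProductSpace ℂ K] (p : Fin 2 × Fin 2 → ℝ)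
    (R : Fin 2 → Fin 2 → Fin 2 → Fin 2 → G →L[ℂ] G) {w : Λ → ℂ}
    {P : Λ → Fin 2 → Fin 2 → Fin 2 → Fin 2 → K →L[ℂ] K}
    {t : Fin 2 → Fin 2 → Fin 2 → Fin 2 → K →L[ℂ] K}
    (h : ∀ a b x y, HasSum (fun l => w l • P l a b x y) (t a b x y)) :
    HasSum (fun l => w l • ∑ a : Fin 2, ∑ b : Fin 2, ∑ x : Fin 2, ∑ y : Fin 2,
        (p (x, y) : ℂ) • opTensor (R a b x y) (P l a b x y))
      (∑ a : Fin 2, ∑ b : Fin 2, ∑ x : Fin 2, ∑ y : Fin 2,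
        (p (x, y) : ℂ) • opTensor (R a b x y) (t a b x y)) := by
  simp only [Finset.smul_sum, smul_smul_opTensor]
  exact hasSum_sum fun a _ => hasSum_sum fun b _ => hasSum_sum fun x _ => hasSum_sum fun y _ =>
    hasSum_smul_opTensor (h a b x y) _ _

/-- Qubit reductions for both parties turn the post-measurement state into a mixture of
post-measurement states of qubit strategies. -/
theorem isQubitMixture_of_isQubitReduction {CA : ι → HA →L[ℂ] Qubit}
    {QA : ι → Fin 2 → Fin 2 → Qubit →L[ℂ] Qubit} {CB : κ → HB →L[ℂ] Qubit}
    {QB : κ → Fin 2 → Fin 2 → Qubit →L[ℂ] Qubit} (S : MeasurementStrategy HA HB)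
    (hA : IsQubitReduction S.M CA QA) (hB : IsQubitReduction S.N CB QB)
    (p : Fin 2 × Fin 2 → ℝ) {ρ : HTensor (HTensor HA HB) HE →L[ℂ] HTensor (HTensor HA HB) HE}
    (hρ : IsDensity ρ) : IsQubitMixture (ι × κ) p (S.postMeasurement p ρ) := by
  obtain ⟨v, hv, hvρ⟩ := hρ.exists_rankOne_decomposition
  obtain ⟨w, σ, hw1, hw, hσ, hσ'⟩ := exists_normalized_compress hρ.1 hv hvρ
    (hasSum_inner_tensorMap_of_isQubitReduction hA hB S.M_sum S.N_sum)
  refine ⟨w, fun l => ⟨QA l.1, QB l.2, hA.pos l.1, hA.sum l.1, hB.pos l.2, hB.sum l.2⟩, σ,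
    fun l => (hw l).nonneg fun _ => sq_nonneg _, hw1, hσ, ?_⟩
  have hP (a b x y : Fin 2) : HasSum (fun l => (w l : ℂ) • partialTrace
      (opTensor (opTensor (QA l.1 x a) (QB l.2 y b)) (1 : HE →L[ℂ] HE) * σ l))
      (partialTrace (opTensor (opTensor (S.M x a) (S.N y b)) (1 : HE →L[ℂ] HE) * ρ)) :=
    (hasSum_congr fun l => (smul_partialTrace_mul_normalized hvρ (hw l) (hσ' l) _).symm).mp
      (hasSum_partialTrace_of_isQubitReduction hA hB hv.summable hvρ hw hw1.summable a b x y)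
  exact hasSum_smul_sum_opTensor p _ hP

end Reductions

/-! ### Qubit reductions from invariant subspaces of dimension at most two. -/

section Blocks

variable {H : Type*} [NormedAddCommGroup H] [InnerProductSpace ℂ H]

theorem exists_linearIsometry_qubit (U : Type*) [NormedAddCommGroup U] [InnerProductSpace ℂ U]
    [FiniteDimensional ℂ U] (hU : Module.finrank ℂ U ≤ 2) : Nonempty (U →ₗᵢ[ℂ] Qubit) := by
  let b := stdOrthonormalBasis ℂ U
  let f : U →ₗ[ℂ] Qubit :=
    b.toBasis.constr ℂ fun i => EuclideanSpace.single (Fin.castLE hU i) (1 : ℂ)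
  have hf : f ∘ b.toBasis = (fun i => EuclideanSpace.single i (1 : ℂ)) ∘ Fin.castLE hU :=
    funext fun i => b.toBasis.constr_basis ℂ _ i
  refine ⟨f.isometryOfOrthonormal (v := b.toBasis) (by simp) ?_⟩
  rw [hf]
  exact EuclideanSpace.orthonormal_single.comp _ (Fin.castLE_injective hU)

/-- A subspace of dimension at most two is the initial space of a partial isometry into `ℂ²`. -/
theorem exists_inner_eq_inner_starProjection (U : Submodule ℂ H) [FiniteDimensional ℂ U]
    (hU : Module.finrank ℂ U ≤ 2) :
    ∃ C : H →L[ℂ] Qubit, ∀ u v, ⟪C u, C v⟫_ℂ = ⟪u, U.starProjection v⟫_ℂ := by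
  obtain ⟨J⟩ := exists_linearIsometry_qubit U hU
  refine ⟨J.toContinuousLinearMap ∘L U.orthogonalProjectionOnto, fun u v => ?_⟩
  have h : ⟪U.orthogonalProjectionOnto u, U.orthogonalProjectionOnto v⟫_ℂ =
      ⟪u, U.starProjection v⟫_ℂ := by
    rw [Submodule.coe_inner, ← Submodule.starProjection_apply, ← Submodule.starProjection_apply,
      Submodule.inner_starProjection_left_eq_right, Submodule.starProjection_eq_self_iff.mpr
        (Submodule.starProjection_apply_mem U v)]
  simpa using h

variable [CompleteSpace H]

/-- Restriction of a pair of two-outcome POVMs to an invariant subspace of dimension at most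
two. -/
theorem exists_qubit_povm_of_invariant {M : Fin 2 → Fin 2 → H →L[ℂ] H}
    (hpos : ∀ x a, (M x a).IsPositive) (hsum : ∀ x, ∑ a, M x a = 1) (U : Submodule ℂ H)
    [FiniteDimensional ℂ U] (hU : Module.finrank ℂ U ≤ 2)
    (hinv : ∀ x a, ∀ v ∈ U, M x a v ∈ U) :
    ∃ (C : H →L[ℂ] Qubit) (Q : Fin 2 → Fin 2 → Qubit →L[ℂ] Qubit), (∀ x a, (Q x a).IsPositive) ∧
      (∀ x, ∑ a, Q x a = 1) ∧
      ∀ x a u v, ⟪C u, Q x a (C v)⟫_ℂ = ⟪u, M x a (U.starProjection v)⟫_ℂ := by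
  obtain ⟨C, hC⟩ := exists_inner_eq_inner_starProjection U hU
  have hCC (v : H) : adjoint C (C v) = U.starProjection v :=
    ext_inner_left ℂ fun u => by rw [adjoint_inner_right, hC]
  have hCP (v : H) : C (U.starProjection v) = C v := by
    rw [← sub_eq_zero, ← map_sub, ← inner_self_eq_zero (𝕜 := ℂ), hC, map_sub,
      Submodule.starProjection_eq_self_iff.mpr (Submodule.starProjection_apply_mem U v), sub_self,
      inner_zero_right]
  -- `C` is a partial isometry with initial projection `C†C = U.starProjection`, so `CC†` is its
  -- final projection.
  have hproj : IsStarProjection (C ∘L adjoint C) := by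
    refine ⟨?_, (isPositive_self_comp_adjoint C).isSelfAdjoint⟩
    ext1 v
    change C (adjoint C (C (adjoint C v))) = C (adjoint C v)
    rw [hCC, hCP]
  have hone : (1 - C ∘L adjoint C).IsPositive := IsPositive.of_isStarProjection hproj.one_sub
  -- If `U` has dimension below two, the conjugated operators sum only to `CC†`. The defect `1 -
  -- CC†` is assigned to outcome `0`; it vanishes on the range of `C`, so matrix elements are
  -- unaffected.
  refine ⟨C, fun x a => C ∘L M x a ∘L adjoint C + if a = 0 then 1 - C ∘L adjoint C else 0,
    fun x a => ?_, fun x => ?_, fun x a u v => ?_⟩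
  · refine ((hpos x a).conj_adjoint C).add ?_
    split_ifs
    exacts [hone, isPositive_zero]
  · have h1 := hsum x
    rw [Fin.sum_univ_two] at h1 ⊢
    have h2 : C ∘L M x 0 ∘L adjoint C + C ∘L M x 1 ∘L adjoint C = C ∘L adjoint C := by
      rw [← comp_add, ← add_comp, h1]; rfl
    beta_reduce
    rw [if_pos rfl, if_neg one_ne_zero, add_zero, add_right_comm, h2, add_sub_cancel]
  · have h1 : (if a = 0 then 1 - C ∘L adjoint C else 0) (C v) = 0 := by
      split_ifs
      · change C v - C (adjoint C (C v)) = 0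
        rw [hCC, hCP, sub_self]
      · rfl
    rw [add_apply, h1, add_zero]
    change ⟪C u, C (M x a (adjoint C (C v)))⟫_ℂ = _
    rw [hCC, hC, Submodule.starProjection_eq_self_iff.mpr
      (hinv x a _ (Submodule.starProjection_apply_mem U v))]

/-- Each block reproduces `M` composed with the block projector; these add up to `M` because the
projectors sum strongly to the identity. -/
theorem exists_isQubitReduction_of_invariant {ι : Type*} {M : Fin 2 → Fin 2 → H →L[ℂ] H}
    (hpos : ∀ x a, (M x a).IsPositive) (hsum : ∀ x, ∑ a, M x a = 1) (U : ι → Submodule ℂ H)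
    [∀ i, FiniteDimensional ℂ (U i)] (hU : ∀ i, Module.finrank ℂ (U i) ≤ 2)
    (hinv : ∀ x a i, ∀ v ∈ U i, M x a v ∈ U i)
    (hs : ∀ v, HasSum (fun i => (U i).starProjection v) v) :
    ∃ C Q, IsQubitReduction (ι := ι) M C Q := by
  choose C Q hQ1 hQ2 hQ3 using fun i =>
    exists_qubit_povm_of_invariant hpos hsum (U i) (hU i) fun x a => hinv x a i
  refine ⟨C, Q, hQ1, hQ2, fun x a u v => ?_⟩
  refine (hasSum_congr fun i => ?_).mp (((hs v).mapL (M x a)).mapL (innerSL ℂ u))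
  rw [hQ3]
  rfl

theorem BlockDecomposition.hasSum_starProjection {ι : Type*} (D : BlockDecomposition ι H) (v : H) :
    HasSum (fun i => (D.block i).starProjection v) v := by
  classical
  have h1 := D.isHilbertSum.hasSum_linearIsometryEquiv_symm (D.isHilbertSum.linearIsometryEquiv v)
  rw [LinearIsometryEquiv.symm_apply_apply] at h1
  refine (hasSum_congr fun i => ?_).mp h1
  set f := D.isHilbertSum.linearIsometryEquiv v
  have h2 := h1.mapL (D.block i).starProjection
  refine HasSum.unique ?_ h2
  have h3 : HasSum (fun j => if j = i then (f i : H) else 0) (f i : H) := hasSum_ite_eq i _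
  refine (hasSum_congr fun j => ?_).mp h3
  split_ifs with h
  · subst h
    exact (Submodule.starProjection_eq_self_iff.mpr (f j).2).symm
  · refine ((Submodule.starProjection_apply_eq_zero_iff _).mpr ?_).symm
    rw [Submodule.mem_orthogonal]
    intro u hu
    exact D.isHilbertSum.OrthogonalFamily (Ne.symm h) ⟨u, hu⟩ (f j)

end Blocks

/-! ### Jordan's lemma on two projections. -/

section Jordan

variable {H : Type*} [NormedAddCommGroup H] [InnerProductSpace ℂ H]

theorem starProjection_eq_add_of_le {U W : Submodule ℂ H} (hUW : U ≤ W) [FiniteDimensional ℂ H]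
    (v : H) :
    W.starProjection v = U.starProjection v + (Uᗮ ⊓ W).starProjection v := by
  refine Submodule.eq_starProjection_of_mem_of_inner_eq_zero ?_ fun w hw => ?_
  · exact W.add_mem (hUW (Submodule.starProjection_apply_mem U v))
      (Submodule.starProjection_apply_mem (Uᗮ ⊓ W) v).2
  · set a := U.starProjection v
    set b := (Uᗮ ⊓ W).starProjection v
    have ha : a ∈ U := Submodule.starProjection_apply_mem U v
    have hb : b ∈ Uᗮ ⊓ W := Submodule.starProjection_apply_mem _ v
    have hva : v - a ∈ Uᗮ := U.sub_starProjection_mem_orthogonal v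
    have hvb : v - b ∈ (Uᗮ ⊓ W)ᗮ := Submodule.sub_starProjection_mem_orthogonal v
    set c := U.starProjection w
    have hc : c ∈ U := Submodule.starProjection_apply_mem U w
    have hd : w - c ∈ Uᗮ ⊓ W :=
      ⟨U.sub_starProjection_mem_orthogonal w, W.sub_mem hw (hUW hc)⟩
    have e1 : ⟪v - (a + b), c⟫_ℂ = 0 := by
      rw [← sub_sub, inner_sub_left, Submodule.inner_left_of_mem_orthogonal hc hva,
        Submodule.inner_left_of_mem_orthogonal hc hb.1, sub_zero]
    have e2 : ⟪v - (a + b), w - c⟫_ℂ = 0 := by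
      rw [add_comm, ← sub_sub, inner_sub_left, Submodule.inner_left_of_mem_orthogonal hd hvb,
        Submodule.inner_right_of_mem_orthogonal ha hd.1, sub_zero]
    rw [← sub_add_cancel w c, inner_add_right, e1, e2, add_zero]

/-- Two reflections preserving a nonzero finite-dimensional space preserve a nonzero subspace of
dimension at most two. -/
theorem exists_invariant_of_involutive {X Y : H →ₗ[ℂ] H} (hX : ∀ v, X (X v) = v)
    (hY : ∀ v, Y (Y v) = v) [FiniteDimensional ℂ H] {W : Submodule ℂ H} (hW : W ≠ ⊥)
    (hXW : ∀ v ∈ W, X v ∈ W) (hYW : ∀ v ∈ W, Y v ∈ W) :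
    ∃ U ≤ W, U ≠ ⊥ ∧ Module.finrank ℂ U ≤ 2 ∧ (∀ v ∈ U, X v ∈ U) ∧ ∀ v ∈ U, Y v ∈ U := by
  have hA (v : H) (hv : v ∈ W) : (X ∘ₗ Y + Y ∘ₗ X) v ∈ W :=
    W.add_mem (hXW _ (hYW v hv)) (hYW _ (hXW v hv))
  have := (Submodule.nontrivial_iff_ne_bot (p := W)).mpr hW
  -- The anticommutator `XY + YX` commutes with the involution `X`, so one of its eigenvectors can
  -- be chosen to be an eigenvector of `X` as well.
  obtain ⟨μ, hμ⟩ := Module.End.exists_eigenvalue ((X ∘ₗ Y + Y ∘ₗ X).restrict hA)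
  obtain ⟨⟨w, hw⟩, hwμ, hw0⟩ := hμ.exists_hasEigenvector
  have hwμ : X (Y w) + Y (X w) = μ • w := congrArg Subtype.val (Module.End.mem_eigenspace_iff.mp hwμ)
  have hw0 : w ≠ 0 := fun h => hw0 (Subtype.ext h)
  obtain ⟨v, ε, hv, hv0, hvX, hvμ⟩ : ∃ (v : H) (ε : ℂ), v ∈ W ∧ v ≠ 0 ∧ X v = ε • v ∧
      X (Y v) + Y (X v) = μ • v := by
    -- Either `w` is a `-1` eigenvector of `X`, or `w + X w` is a `+1` eigenvector in the same
    -- eigenspace of the anticommutator.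
    by_cases h : w + X w = 0
    · exact ⟨w, -1, hw, hw0, by rw [neg_smul, one_smul]; exact (neg_eq_of_add_eq_zero_right h).symm,
        hwμ⟩
    · refine ⟨w + X w, 1, W.add_mem hw (hXW w hw), h, ?_, ?_⟩
      · rw [map_add, hX, one_smul, add_comm]
      · have h1 := congrArg X hwμ
        rw [map_add, hX, map_smul] at h1
        rw [map_add, map_add, map_add, map_add, hX, smul_add, ← hwμ, ← h1]
        abel
  have hvU : v ∈ Submodule.span ℂ {v, Y v} := Submodule.subset_span (by simp)
  have hYvU : Y v ∈ Submodule.span ℂ {v, Y v} := Submodule.subset_span (by simp)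
  refine ⟨Submodule.span ℂ {v, Y v}, ?_, ?_, ?_, ?_, ?_⟩
  · exact Submodule.span_le.mpr (Set.pair_subset hv (hYW v hv))
  · exact fun h => hv0 ((Submodule.mem_bot ℂ).mp (h ▸ hvU))
  · classical
    have h := finrank_span_finset_le_card (R := ℂ) ({v, Y v} : Finset H)
    rw [Set.finrank, Finset.coe_pair] at h
    exact h.trans Finset.card_le_two
  · have hle : Submodule.span ℂ {v, Y v} ≤ (Submodule.span ℂ {v, Y v}).comap X := by
      refine Submodule.span_le.mpr (Set.pair_subset ?_ ?_)
      · change X v ∈ Submodule.span ℂ {v, Y v}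
        rw [hvX]
        exact Submodule.smul_mem _ _ hvU
      · change X (Y v) ∈ Submodule.span ℂ {v, Y v}
        -- The anticommutator relation gives `X (Y v) = μ v - ε Y v`, which closes the span of `v`
        -- and `Y v` under `X`.
        rw [eq_sub_of_add_eq hvμ, hvX, map_smul]
        exact Submodule.sub_mem _ (Submodule.smul_mem _ _ hvU) (Submodule.smul_mem _ _ hYvU)
    exact hle
  · have hle : Submodule.span ℂ {v, Y v} ≤ (Submodule.span ℂ {v, Y v}).comap Y := by
      refine Submodule.span_le.mpr (Set.pair_subset hYvU ?_)
      change Y (Y v) ∈ Submodule.span ℂ {v, Y v}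
      rwa [hY]
    exact hle

variable [FiniteDimensional ℂ H] {P Q : H →L[ℂ] H}

/-- A projection `T` and the reflection `2T - 1` have the same invariant subspaces. -/
theorem exists_invariant_of_projections (hP : IsStarProjection P) (hQ : IsStarProjection Q)
    {W : Submodule ℂ H} (hW : W ≠ ⊥) (hPW : ∀ v ∈ W, P v ∈ W) (hQW : ∀ v ∈ W, Q v ∈ W) :
    ∃ U ≤ W, U ≠ ⊥ ∧ Module.finrank ℂ U ≤ 2 ∧ (∀ v ∈ U, P v ∈ U) ∧ ∀ v ∈ U, Q v ∈ U := by
  have hinv {T : H →L[ℂ] H} (hT : IsStarProjection T) (v : H) :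
      ((2 : ℂ) • T - 1 : H →L[ℂ] H) (((2 : ℂ) • T - 1 : H →L[ℂ] H) v) = v := by
    have h : T (T v) = T v := congrArg (fun R : H →L[ℂ] H => R v) hT.isIdempotentElem
    simp only [sub_apply, smul_apply, one_apply_eq_self, map_sub, map_smul, h]
    module
  have hmem {T : H →L[ℂ] H} {V : Submodule ℂ H} (h : ∀ v ∈ V, T v ∈ V) (v : H) (hv : v ∈ V) :
      ((2 : ℂ) • T - 1 : H →L[ℂ] H) v ∈ V :=
    V.sub_mem (V.smul_mem _ (h v hv)) hv
  have hback {T : H →L[ℂ] H} {V : Submodule ℂ H}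
      (h : ∀ v ∈ V, ((2 : ℂ) • T - 1 : H →L[ℂ] H) v ∈ V) (v : H) (hv : v ∈ V) : T v ∈ V := by
    have e : T v = (2⁻¹ : ℂ) • (((2 : ℂ) • T - 1 : H →L[ℂ] H) v + v) := by
      simp only [sub_apply, smul_apply, one_apply_eq_self]
      module
    rw [e]
    exact V.smul_mem _ (V.add_mem (h v hv) hv)
  obtain ⟨U, h1, h2, h3, h4, h5⟩ := exists_invariant_of_involutive
    (X := ((2 : ℂ) • P - 1 : H →L[ℂ] H)) (Y := ((2 : ℂ) • Q - 1 : H →L[ℂ] H))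
    (hinv hP) (hinv hQ) hW (hmem hPW) (hmem hQW)
  exact ⟨U, h1, h2, h3, hback h4, hback h5⟩

/-- Jordan's lemma: two projections on a finite-dimensional space are simultaneously block
diagonal, with blocks of dimension at most two. -/
theorem exists_blocks_of_projections (hP : IsStarProjection P) (hQ : IsStarProjection Q)
    (W : Submodule ℂ H) (hPW : ∀ v ∈ W, P v ∈ W) (hQW : ∀ v ∈ W, Q v ∈ W) :
    ∃ (ι : Type) (_ : Fintype ι) (U : ι → Submodule ℂ H), (∀ i, Module.finrank ℂ (U i) ≤ 2) ∧
      (∀ i, ∀ v ∈ U i, P v ∈ U i) ∧ (∀ i, ∀ v ∈ U i, Q v ∈ U i) ∧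
      ∀ v, ∑ i, (U i).starProjection v = W.starProjection v := by
  -- Induction on the dimension: split off a small invariant `U` and continue in `Uᗮ ⊓ W`, which is
  -- invariant because the projections are self-adjoint.
  induction hn : Module.finrank ℂ W using Nat.strong_induction_on generalizing W with
  | _ n ih =>
    by_cases hW : W = ⊥
    · exact ⟨Empty, inferInstance, fun i => i.elim, fun i => i.elim, fun i => i.elim,
        fun i => i.elim, fun v => by simp [hW]⟩
    obtain ⟨U, hUW, hU0, hU2, hPU, hQU⟩ := exists_invariant_of_projections hP hQ hW hPW hQW
    have horth {T : H →L[ℂ] H} (hT : IsStarProjection T) (hTU : ∀ v ∈ U, T v ∈ U)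
        (hTW : ∀ v ∈ W, T v ∈ W) : ∀ v ∈ Uᗮ ⊓ W, T v ∈ Uᗮ ⊓ W := by
      refine fun v hv => ⟨?_, hTW v hv.2⟩
      refine (Submodule.mem_orthogonal U _).mpr fun u hu => ?_
      have hadj : adjoint T = T := hT.isSelfAdjoint
      rw [← adjoint_inner_left, hadj]
      exact (Submodule.mem_orthogonal U v).mp hv.1 _ (hTU u hu)
    have hlt : Uᗮ ⊓ W < W := by
      refine lt_of_le_of_ne inf_le_right fun h => hU0 ?_
      have : U ≤ Uᗮ := hUW.trans (inf_eq_right.mp h)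
      exact (Submodule.isOrtho_self).mp this
    obtain ⟨ι, _, V, h1, h2, h3, h4⟩ := ih _ (hn ▸ Submodule.finrank_lt_finrank_of_lt hlt)
      (Uᗮ ⊓ W) (horth hP hPU hPW) (horth hQ hQU hQW) rfl
    refine ⟨Option ι, inferInstance, fun o => o.elim U V, ?_, ?_, ?_, fun v => ?_⟩
    · rintro (_ | i)
      exacts [hU2, h1 i]
    · rintro (_ | i)
      exacts [hPU, h2 i]
    · rintro (_ | i)
      exacts [hQU, h3 i]
    · rw [Fintype.sum_option, starProjection_eq_add_of_le hUW, ← h4]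
      rfl

end Jordan

/-! ### From projections to general effects by convexity. -/

section Effects

variable {H : Type*} [NormedAddCommGroup H] [InnerProductSpace ℂ H]

/-- `M` has a qubit reduction indexed by a finite type. -/
def HasFiniteQubitReduction (M : Fin 2 → Fin 2 → H →L[ℂ] H) : Prop :=
  ∃ (ι : Type) (_ : Fintype ι) (C : ι → H →L[ℂ] Qubit)
    (Q : ι → Fin 2 → Fin 2 → Qubit →L[ℂ] Qubit), IsQubitReduction M C Q

/-- Take the disjoint union of the two reductions. The operators `C` enter quadratically, so the
coefficients `s` and `t` are absorbed as `√s` and `√t`. -/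
theorem convex_hasFiniteQubitReduction :
    Convex ℝ {M : Fin 2 → Fin 2 → H →L[ℂ] H | HasFiniteQubitReduction M} := by
  rintro M ⟨ι, _, C, Q, h⟩ M' ⟨κ, _, C', Q', h'⟩ s t hs ht -
  refine ⟨ι ⊕ κ, inferInstance, Sum.elim (fun i => (√s : ℂ) • C i) (fun j => (√t : ℂ) • C' j),
    Sum.elim Q Q', ?_, ?_, fun x a u v => ?_⟩
  · rintro (i | j)
    exacts [h.pos i, h'.pos j]
  · rintro (i | j)
    exacts [h.sum i, h'.sum j]
  · have hsm (r : ℝ) (hr : 0 ≤ r) (T : H →L[ℂ] Qubit) (R : Qubit →L[ℂ] Qubit) :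
        ⟪((√r : ℂ) • T) u, R (((√r : ℂ) • T) v)⟫_ℂ = (r : ℂ) * ⟪T u, R (T v)⟫_ℂ := by
      rw [smul_apply, smul_apply, map_smul, inner_smul_left, inner_smul_right, Complex.conj_ofReal,
        ← mul_assoc, ← Complex.ofReal_mul, Real.mul_self_sqrt hr]
    have e : ⟪u, (s • M + t • M') x a v⟫_ℂ =
        (s : ℂ) * ⟪u, M x a v⟫_ℂ + (t : ℂ) * ⟪u, M' x a v⟫_ℂ := by
      simp only [Pi.add_apply, Pi.smul_apply, add_apply, smul_apply, inner_add_right,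
        inner_smul_right_eq_smul, Complex.real_smul]
    have e1 := (hasSum_fintype _).unique (h.hasSum x a u v)
    have e2 := (hasSum_fintype _).unique (h'.hasSum x a u v)
    have hh := hasSum_fintype fun l : ι ⊕ κ =>
      ⟪Sum.elim (fun i => (√s : ℂ) • C i) (fun j => (√t : ℂ) • C' j) l u, Sum.elim Q Q' l x a
        (Sum.elim (fun i => (√s : ℂ) • C i) (fun j => (√t : ℂ) • C' j) l v)⟫_ℂ
    rw [Fintype.sum_sum_type] at hh
    simp only [Sum.elim_inl, Sum.elim_inr, hsm _ hs, hsm _ ht, ← Finset.mul_sum, e1, e2] at hh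
    rw [e]
    exact hh

/-- The pair of two-outcome POVMs `(E, 1 - E)` and `(F, 1 - F)`. -/
def effectPair (E F : H →L[ℂ] H) : Fin 2 → Fin 2 → H →L[ℂ] H := ![![E, 1 - E], ![F, 1 - F]]

theorem effectPair_combo_left {E E' F : H →L[ℂ] H} {s t : ℝ} (hst : s + t = 1) :
    effectPair (s • E + t • E') F = s • effectPair E F + t • effectPair E' F := by
  have h (T : H →L[ℂ] H) : s • T + t • T = T := by rw [← add_smul, hst, one_smul]
  have h1 : (1 : H →L[ℂ] H) - (s • E + t • E') = s • (1 - E) + t • (1 - E') := by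
    nth_rw 1 [← h 1]
    module
  funext x a
  fin_cases x <;> fin_cases a <;> simp [effectPair, h, h1]

theorem effectPair_combo_right {E F F' : H →L[ℂ] H} {s t : ℝ} (hst : s + t = 1) :
    effectPair E (s • F + t • F') = s • effectPair E F + t • effectPair E F' := by
  have h (T : H →L[ℂ] H) : s • T + t • T = T := by rw [← add_smul, hst, one_smul]
  have h1 : (1 : H →L[ℂ] H) - (s • F + t • F') = s • (1 - F) + t • (1 - F') := by
    nth_rw 1 [← h 1]
    module
  funext x a
  fin_cases x <;> fin_cases a <;> simp [effectPair, h, h1]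

variable [FiniteDimensional ℂ H]

/-- A convex set of operators containing all projections contains all effects. -/
theorem effect_mem_of_convex {S : Set (H →L[ℂ] H)} (hS : Convex ℝ S)
    (hproj : ∀ P, IsStarProjection P → P ∈ S) {E : H →L[ℂ] H} (h0 : E.IsPositive)
    (h1 : (1 - E).IsPositive) : E ∈ S := by
  have hsym : (E : H →ₗ[ℂ] H).IsSymmetric := h0.isSymmetric
  set b := hsym.eigenvectorBasis rfl
  set e := hsym.eigenvalues rfl
  have hb (i) : E (b i) = (e i : ℂ) • b i := hsym.apply_eigenvectorBasis rfl i
  -- `L` sends real coefficients to the operator diagonal in the eigenbasis of `E`. Vertices of the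
  -- unit cube go to projections, `E` is the image of a point of the cube, and the cube is the
  -- convex hull of its vertices.
  set L := Fintype.linearCombination ℝ fun i => InnerProductSpace.rankOne ℂ (b i) (b i) with hL
  have hLb (f : Fin (Module.finrank ℂ H) → ℝ) (i) : L f (b i) = (f i : ℂ) • b i := by
    rw [hL, Fintype.linearCombination_apply, sum_apply, Finset.sum_eq_single i]
    · rw [smul_apply, InnerProductSpace.rankOne_apply, inner_self_eq_ofReal, b.norm_eq_one]
      simp
    · intro j _ hj
      rw [smul_apply, InnerProductSpace.rankOne_apply, b.inner_eq_zero hj, zero_smul, smul_zero]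
    · exact fun h => (h (Finset.mem_univ i)).elim
  have hext {T T' : H →L[ℂ] H} (h : ∀ i, T (b i) = T' (b i)) : T = T' :=
    ContinuousLinearMap.coe_injective (b.toBasis.ext fun i => by simpa using h i)
  have hE : L e = E := hext fun i => by rw [hLb, hb]
  have hvert : Set.univ.pi (fun _ => ({0, 1} : Set ℝ)) ⊆ L ⁻¹' S := by
    intro f hf
    refine hproj _ ⟨hext fun i => ?_, ?_⟩
    · rw [mul_apply_eq_comp, hLb, map_smul, hLb, smul_smul]
      rcases hf i (Set.mem_univ i) with h | h <;> simp_all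
    · rw [hL, Fintype.linearCombination_apply]
      refine isSelfAdjoint_sum _ fun i _ => ?_
      exact (IsSelfAdjoint.all (f i)).smul (InnerProductSpace.isPositive_rankOne_self (b i)).isSelfAdjoint
  have hcube : e ∈ Set.univ.pi fun _ => convexHull ℝ ({0, 1} : Set ℝ) := by
    intro i _
    rw [convexHull_pair, segment_eq_Icc zero_le_one]
    have hi : (⟪b i, E (b i)⟫_ℂ).re = e i := by
      rw [hb, inner_smul_right, inner_self_eq_ofReal, b.norm_eq_one]
      simp
    have h2 := h0.re_inner_nonneg_right (b i)
    have h3 := h1.re_inner_nonneg_right (b i)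
    rw [sub_apply, one_apply_eq_self, inner_sub_right, map_sub, inner_self_eq_ofReal,
      b.norm_eq_one] at h3
    simp only [RCLike.re_eq_complex_re, hi, Complex.ofReal_re] at h2 h3
    exact ⟨h2, by linarith⟩
  have := convexHull_min hvert (hS.linear_preimage L)
  rw [convexHull_pi] at this
  exact hE ▸ this hcube

theorem hasFiniteQubitReduction_of_projections {P Q : H →L[ℂ] H} (hP : IsStarProjection P)
    (hQ : IsStarProjection Q) : HasFiniteQubitReduction (effectPair P Q) := by
  obtain ⟨ι, _, U, h1, h2, h3, h4⟩ := exists_blocks_of_projections hP hQ ⊤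
    (fun _ _ => Submodule.mem_top) fun _ _ => Submodule.mem_top
  refine ⟨ι, inferInstance, exists_isQubitReduction_of_invariant ?_ ?_ U h1 ?_ fun v => ?_⟩
  · intro x a
    fin_cases x <;> fin_cases a
    exacts [.of_isStarProjection hP, .of_isStarProjection hP.one_sub, .of_isStarProjection hQ,
      .of_isStarProjection hQ.one_sub]
  · intro x
    fin_cases x <;> simp [effectPair]
  · intro x a i v hv
    fin_cases x <;> fin_cases a
    exacts [h2 i v hv, (U i).sub_mem hv (h2 i v hv), h3 i v hv, (U i).sub_mem hv (h3 i v hv)]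
  · have := hasSum_fintype fun i => (U i).starProjection v
    rwa [h4, Submodule.starProjection_eq_self_iff.mpr Submodule.mem_top] at this

theorem hasFiniteQubitReduction_of_povm {M : Fin 2 → Fin 2 → H →L[ℂ] H}
    (hpos : ∀ x a, (M x a).IsPositive) (hsum : ∀ x, ∑ a, M x a = 1) :
    HasFiniteQubitReduction M := by
  have hcompl (x : Fin 2) : M x 1 = 1 - M x 0 := by
    rw [← hsum x, Fin.sum_univ_two, add_sub_cancel_left]
  have hM : M = effectPair (M 0 0) (M 1 0) := by
    funext x a
    fin_cases x <;> fin_cases a <;> simp [effectPair, hcompl]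
  have hc (x : Fin 2) : (1 - M x 0).IsPositive := hcompl x ▸ hpos x 1
  rw [hM]
  -- Convexity is used in one effect at a time: the first is reduced to a projection `P` with `M 1
  -- 0` fixed, then the second to a projection `Q` with `P` fixed.
  refine effect_mem_of_convex (S := {E | HasFiniteQubitReduction (effectPair E (M 1 0))}) ?_
    (fun P hP => effect_mem_of_convex (S := {F | HasFiniteQubitReduction (effectPair P F)}) ?_
      (fun Q hQ => hasFiniteQubitReduction_of_projections hP hQ) (hpos 1 0) (hc 1))
    (hpos 0 0) (hc 0)
  · intro E hE E' hE' s t hs ht hst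
    change HasFiniteQubitReduction _
    rw [effectPair_combo_left hst]
    exact convex_hasFiniteQubitReduction hE hE' hs ht hst
  · intro F hF F' hF' s t hs ht hst
    change HasFiniteQubitReduction _
    rw [effectPair_combo_right hst]
    exact convex_hasFiniteQubitReduction hF hF' hs ht hst

end Effects

theorem IsQubitMixture.congr {Λ Λ' HE : Type*} [NormedAddCommGroup HE] [InnerProductSpace ℂ HE]
    [CompleteSpace HE] {p : Fin 2 × Fin 2 → ℝ} {τ : OutSpace HE →L[ℂ] OutSpace HE} (e : Λ' ≃ Λ)
    (h : IsQubitMixture Λ p τ) : IsQubitMixture Λ' p τ := by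
  obtain ⟨w, S, σ, h0, h1, h2, h3⟩ := h
  refine ⟨fun l => w (e l), fun l => S (e l), fun l => σ (e l), fun l => h0 _,
    e.hasSum_iff.mpr h1, fun l => h2 _, ?_⟩
  rw [← e.hasSum_iff] at h3
  exact h3

end BellStrategy

end

/-! ### Assembly of the two claims. -/

theorem mainTheorem1 {HA HB HE : Type*}
    [NormedAddCommGroup HA] [InnerProductSpace ℂ HA] [CompleteSpace HA]
    [NormedAddCommGroup HB] [InnerProductSpace ℂ HB] [CompleteSpace HB]
    [NormedAddCommGroup HE] [InnerProductSpace ℂ HE] [CompleteSpace HE]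
    (p : Fin 2 × Fin 2 → ℝ) (hp : p ∈ stdSimplex ℝ (Fin 2 × Fin 2))
    (S : BellStrategy.MeasurementStrategy HA HB)
    (ρ : BellStrategy.HTensor (BellStrategy.HTensor HA HB) HE →L[ℂ]
      BellStrategy.HTensor (BellStrategy.HTensor HA HB) HE)
    (hρ : BellStrategy.IsDensity ρ) :
    (∀ {ι κ : Type*} (D : BellStrategy.BlockDecomposition ι HA)
        (D' : BellStrategy.BlockDecomposition κ HB),
      S.IsBlockDiagonal D D' → BellStrategy.IsBlockState D D' ρ →
        BellStrategy.IsQubitMixture (ι × κ) p (S.postMeasurement p ρ)) ∧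
    (FiniteDimensional ℂ HA → FiniteDimensional ℂ HB →
      ∃ n : ℕ, BellStrategy.IsQubitMixture (Fin n) p (S.postMeasurement p ρ)) := by
  open BellStrategy in
  refine ⟨fun D D' hD _ => ?_, fun _ _ => ?_⟩
  · obtain ⟨CA, QA, hA⟩ := exists_isQubitReduction_of_invariant S.M_pos S.M_sum D.block
      (fun i => (D.finrank_block i).le) hD.2.1 D.hasSum_starProjection
    obtain ⟨CB, QB, hB⟩ := exists_isQubitReduction_of_invariant S.N_pos S.N_sum D'.block
      (fun j => (D'.finrank_block j).le) hD.2.2 D'.hasSum_starProjection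
    exact isQubitMixture_of_isQubitReduction S hA hB p hρ
  · obtain ⟨ι, _, CA, QA, hA⟩ := hasFiniteQubitReduction_of_povm S.M_pos S.M_sum
    obtain ⟨κ, _, CB, QB, hB⟩ := hasFiniteQubitReduction_of_povm S.N_pos S.N_sum
    exact ⟨Fintype.card (ι × κ), (isQubitMixture_of_isQubitReduction S hA hB p hρ).congr
      (Fintype.equivFin (ι × κ)).symm⟩
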